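/- For an increasing function $\varphi:[0,\infty)\to\mathbb R$ let $$\mathcal F_\varphi=\Bigl\{f:\mathbb C\to\mathbb C \text{ entire} : \|f\|_\varphi^2=\int_{\mathbb C}|f(z)|^2e^{-2\varphi(|z|)}\,dm(z)<\infty\Bigr\},$$ where $m$ is area Lebesgue measure. This is a Hilbert space with the inner product $\langle f,g\rangle_\varphi=\int_{\mathbb C}f\,\overline g\,e^{-2\varphi(|z|)}\,dm$, on which point evaluations are bounded; let $\mathbf k_\lambda\in\mathcal F_\varphi$ be the reproducing kernel at $\lambda$, so that $f(\lambda)=\langle f,\mathbf k_\lambda\rangle_\varphi$ for all $f\in\mathcal F_\varphi$, and let $\Bbbk_\lambda=\mathbf k_\lambda/\|\mathbf k_\lambda\|_\varphi$ be the normalized reproducing kernel. **Theorem.** Let $\varphi(r)=(\log^+r)^2$, where $\log^+ r=\max(0,\log r)$ for $r>0$ and $\log^+0=0$. Let $(\theta_n)_{n\ge0}$ be arbitrary real numbers and $$\Lambda=\{\lambda_n\}_{n\ge0},\qquad \lambda_n=\exp\Bigl(\frac{n+1}2+i\theta_n\Bigr).$$ Then $\{\Bbbk_\lambda\}_{\lambda\in\Lambda}$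 is a Riesz basis of $\mathcal F_\varphi$, that is, its linear span is dense in $\mathcal F_\varphi$ and there are constants $c,C>0$ such that $$c\sum_{\lambda\in\Lambda}|a_\lambda|^2\le\Bigl\|\sum_{\lambda\in\Lambda}a_\lambda\Bbbk_\lambda\Bigr\|_\varphi^2\le C\sum_{\lambda\in\Lambda}|a_\lambda|^2$$ for every finitely supported family $(a_\lambda)_{\lambda\in\Lambda}$ of complex numbers. Equivalently, and hence also, $\Lambda$ is a complete interpolating sequence for $\mathcal F_\varphi$: for each $(a_\lambda)\in\ell^2(\Lambda)$ there is exactly one $f\in\mathcal F_\varphi$ with $f(\lambda)/\|\mathbf k_\lambda\|_\varphi=a_\lambda$ for all $\lambda\in\Lambda$. -/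

import Mathlib

open MeasureTheory Filter Topology Set
open scoped NNReal ENNReal ComplexConjugate InnerProductSpace

noncomputable section

namespace Fock

/-- The factor `e^{-φ(|z|)}`, for an increasing function `φ` on `[0, ∞)`. -/
def decay (φ : ℝ≥0 →o ℝ) (z : ℂ) : ℝ := Real.exp (-φ ‖z‖₊)

theorem decay_pos (φ : ℝ≥0 →o ℝ) (z : ℂ) : 0 < decay φ z := Real.exp_pos _

theorem decay_sq (φ : ℝ≥0 →o ℝ) (z : ℂ) : decay φ z ^ 2 = Real.exp (-2 * φ ‖z‖₊) := by
  rw [decay, ← Real.exp_nat_mul]; congr 1; push_cast; ring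

theorem measurable_decay (φ : ℝ≥0 →o ℝ) : Measurable (decay φ) :=
  (φ.monotone.measurable.comp measurable_nnnorm).neg.exp

/-- The function `z ↦ f(z) e^{-φ(|z|)}`. -/
def wt (φ : ℝ≥0 →o ℝ) (f : ℂ → ℂ) (z : ℂ) : ℂ := f z * decay φ z

theorem norm_wt_sq (φ : ℝ≥0 →o ℝ) (f : ℂ → ℂ) (z : ℂ) :
    ‖wt φ f z‖ ^ 2 = ‖f z‖ ^ 2 * Real.exp (-2 * φ ‖z‖₊) := by
  rw [wt, norm_mul, mul_pow, Complex.norm_real, Real.norm_eq_abs, sq_abs, decay_sq]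

theorem aesm_wt (φ : ℝ≥0 →o ℝ) {f : ℂ → ℂ} (hf : Differentiable ℂ f) :
    AEStronglyMeasurable (wt φ f) volume :=
  (hf.continuous.measurable.mul
    (Complex.measurable_ofReal.comp (measurable_decay φ))).aestronglyMeasurable

theorem integrable_iff_memLp (φ : ℝ≥0 →o ℝ) {f : ℂ → ℂ} (hf : Differentiable ℂ f) :
    Integrable (fun z : ℂ => ‖f z‖ ^ 2 * Real.exp (-2 * φ ‖z‖₊)) ↔ MemLp (wt φ f) 2 volume := by
  rw [memLp_two_iff_integrable_sq_norm (aesm_wt φ hf)]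
  simp_rw [norm_wt_sq]

/-- The entire functions `f` with `∫ |f(z)|² e^{-2φ(|z|)} dm(z) < ∞`. -/
def space (φ : ℝ≥0 →o ℝ) : Submodule ℂ (ℂ → ℂ) where
  carrier := {f | Differentiable ℂ f ∧
    Integrable (fun z : ℂ => ‖f z‖ ^ 2 * Real.exp (-2 * φ ‖z‖₊)) volume}
  zero_mem' := ⟨differentiable_const _, by simp⟩
  add_mem' := by
    rintro f g ⟨hf, hf'⟩ ⟨hg, hg'⟩
    refine ⟨hf.add hg, ?_⟩
    rw [integrable_iff_memLp φ hf] at hf'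
    rw [integrable_iff_memLp φ hg] at hg'
    rw [integrable_iff_memLp φ (hf.add hg)]
    convert hf'.add hg' using 1
    ext z; simp [wt, add_mul]
  smul_mem' := by
    rintro c f ⟨hf, hf'⟩
    refine ⟨hf.const_smul c, ?_⟩
    rw [integrable_iff_memLp φ hf] at hf'
    rw [integrable_iff_memLp φ (hf.const_smul c)]
    convert hf'.const_smul c using 1
    ext z; simp [wt, mul_assoc]

end Fock

/-- The Fock type space `F_φ` of an increasing function `φ` on `[0, ∞)`. -/
def FockSpace (φ : ℝ≥0 →o ℝ) : Type := ↥(Fock.space φ)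

namespace FockSpace

variable {φ : ℝ≥0 →o ℝ}

instance : AddCommGroup (FockSpace φ) := inferInstanceAs (AddCommGroup ↥(Fock.space φ))
instance : Module ℂ (FockSpace φ) := inferInstanceAs (Module ℂ ↥(Fock.space φ))

/-- The entire function underlying an element of `F_φ`. -/
def toFun (f : FockSpace φ) : ℂ → ℂ := Subtype.val f

theorem toFun_injective : Function.Injective (toFun : FockSpace φ → ℂ → ℂ) :=
  Subtype.val_injective

theorem toFun_add (f g : FockSpace φ) : (f + g).toFun = f.toFun + g.toFun := rfl
theorem toFun_sub (f g : FockSpace φ) : (f - g).toFun = f.toFun - g.toFun := rfl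
theorem toFun_smul (c : ℂ) (f : FockSpace φ) : (c • f).toFun = c • f.toFun := rfl

theorem differentiable (f : FockSpace φ) : Differentiable ℂ f.toFun := f.2.1

theorem integrable_norm_sq (f : FockSpace φ) :
    Integrable (fun z : ℂ => ‖f.toFun z‖ ^ 2 * Real.exp (-2 * φ ‖z‖₊)) volume := f.2.2

theorem memLp_wt (f : FockSpace φ) : MemLp (Fock.wt φ f.toFun) 2 volume :=
  (Fock.integrable_iff_memLp φ f.differentiable).1 f.integrable_norm_sq

theorem integrable_inner (f g : FockSpace φ) :
    Integrable (fun z : ℂ =>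
      conj (f.toFun z) * g.toFun z * (Real.exp (-2 * φ ‖z‖₊) : ℂ)) volume := by
  have h := L2.integrable_inner (𝕜 := ℂ) f.memLp_wt.toLp g.memLp_wt.toLp
  refine h.congr ?_
  filter_upwards [f.memLp_wt.coeFn_toLp, g.memLp_wt.coeFn_toLp] with z h1 h2
  rw [h1, h2, ← Fock.decay_sq, RCLike.inner_apply]
  simp only [Fock.wt, map_mul, Complex.conj_ofReal]
  push_cast
  ring

/-- The inner product `∫ conj (f z) g(z) e^{-2φ(|z|)} dm(z)`, linear in the second argument. -/
@[reducible] def core (φ : ℝ≥0 →o ℝ) : InnerProductSpace.Core ℂ (FockSpace φ) where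
  inner f g := ∫ z : ℂ, conj (f.toFun z) * g.toFun z * (Real.exp (-2 * φ ‖z‖₊) : ℂ)
  conj_inner_symm f g := by
    rw [← integral_conj]
    congr 1; ext z
    simp only [map_mul, Complex.conj_conj, Complex.conj_ofReal]
    ring
  re_inner_nonneg f := by
    have : ∀ z : ℂ, conj (f.toFun z) * f.toFun z * (Real.exp (-2 * φ ‖z‖₊) : ℂ)
        = ((‖f.toFun z‖ ^ 2 * Real.exp (-2 * φ ‖z‖₊) : ℝ) : ℂ) := by
      intro z; rw [Complex.conj_mul']; push_cast; ring
    simp only [this]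
    rw [integral_complex_ofReal]
    rw [RCLike.re_eq_complex_re, Complex.ofReal_re]
    exact integral_nonneg fun z => by positivity
  add_left f g h := by
    rw [← integral_add (integrable_inner f h) (integrable_inner g h)]
    congr 1; ext z
    simp only [toFun_add, Pi.add_apply, map_add]; ring
  smul_left f g c := by
    rw [← integral_const_mul]
    congr 1; ext z
    simp only [toFun_smul, Pi.smul_apply, smul_eq_mul, map_mul]; ring
  definite f hf := by
    have : ∀ z : ℂ, conj (f.toFun z) * f.toFun z * (Real.exp (-2 * φ ‖z‖₊) : ℂ)
        = ((‖f.toFun z‖ ^ 2 * Real.exp (-2 * φ ‖z‖₊) : ℝ) : ℂ) := by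
      intro z; rw [Complex.conj_mul']; push_cast; ring
    simp only [this] at hf
    rw [integral_complex_ofReal] at hf
    have hf' := Complex.ofReal_eq_zero.1 hf
    rw [integral_eq_zero_iff_of_nonneg (fun z => by positivity) f.integrable_norm_sq] at hf'
    have h0 : f.toFun =ᵐ[volume] (0 : ℂ → ℂ) := by
      filter_upwards [hf'] with z hz
      have := (mul_eq_zero.1 hz).resolve_right (Real.exp_pos _).ne'
      simpa using this
    exact toFun_injective (f.differentiable.continuous.ae_eq_iff_eq volume
      continuous_const |>.1 h0)

instance : NormedAddCommGroup (FockSpace φ) :=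
  @InnerProductSpace.Core.toNormedAddCommGroup ℂ (FockSpace φ) _ _ _ (core φ)

instance : InnerProductSpace ℂ (FockSpace φ) :=
  InnerProductSpace.ofCore (core φ).toCore

theorem inner_def (f g : FockSpace φ) : ⟪f, g⟫_ℂ =
    ∫ z : ℂ, conj (f.toFun z) * g.toFun z * (Real.exp (-2 * φ ‖z‖₊) : ℂ) := rfl

theorem norm_sq_eq (f : FockSpace φ) :
    ‖f‖ ^ 2 = ∫ z : ℂ, ‖f.toFun z‖ ^ 2 * Real.exp (-2 * φ ‖z‖₊) := by
  have : ∀ z : ℂ, conj (f.toFun z) * f.toFun z * (Real.exp (-2 * φ ‖z‖₊) : ℂ)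
      = ((‖f.toFun z‖ ^ 2 * Real.exp (-2 * φ ‖z‖₊) : ℝ) : ℂ) := by
    intro z; rw [Complex.conj_mul']; push_cast; ring
  have h := inner_self_eq_norm_sq_to_K (𝕜 := ℂ) f
  rw [inner_def] at h
  simp only [this] at h
  rw [integral_complex_ofReal] at h
  exact Complex.ofReal_injective (by rw [Complex.ofReal_pow]; exact h.symm)

theorem pi_mul_eq_setIntegral {G : ℂ → ℂ} (hG : Differentiable ℂ G) :
    (Real.pi : ℂ) * G 0 = ∫ z in Metric.ball (0 : ℂ) 1, G z := by
  have hrot : ∀ t : ℝ, ∫ z in Metric.ball (0 : ℂ) 1, G (circleMap 0 1 t * z)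
      = ∫ z in Metric.ball (0 : ℂ) 1, G z := by
    intro t
    set c : Circle := Circle.exp t
    have hc : circleMap 0 1 t = (c : ℂ) := by simp [circleMap, c, Circle.coe_exp]
    have hmp := (rotation c).measurePreserving
    have := hmp.setIntegral_preimage_emb (rotation c).toHomeomorph.measurableEmbedding G
      (Metric.ball (0 : ℂ) 1)
    rw [← this, hc]
    have hpre : (rotation c) ⁻¹' Metric.ball (0 : ℂ) 1 = Metric.ball (0 : ℂ) 1 := by
      ext z; simp only [mem_preimage, mem_ball_zero_iff, LinearIsometryEquiv.norm_map]
    rw [hpre]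
    simp [rotation_apply]
  have havg : ∀ z : ℂ, ∫ t in (0 : ℝ)..2 * Real.pi, G (circleMap 0 1 t * z)
      = 2 * Real.pi * G 0 := by
    intro z
    have h : Differentiable ℂ fun c : ℂ => G (c * z) := hG.comp (differentiable_id.mul_const z)
    have := (h.diffContOnCl (s := Metric.ball (0 : ℂ) |1|)).circleAverage
    rw [Real.circleAverage_def, zero_mul] at this
    rw [← this, Complex.real_smul]
    have := Real.pi_ne_zero
    push_cast
    rw [← mul_assoc, mul_inv_cancel₀, one_mul]
    exact_mod_cast mul_ne_zero two_ne_zero this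
  have hcont : Continuous fun p : ℝ × ℂ => G (circleMap 0 1 p.1 * p.2) :=
    hG.continuous.comp (((continuous_circleMap 0 1).comp continuous_fst).mul continuous_snd)
  have hint : Integrable (Function.uncurry fun (t : ℝ) (z : ℂ) => G (circleMap 0 1 t * z))
      ((volume.restrict (Ioc 0 (2 * Real.pi))).prod
        (volume.restrict (Metric.ball (0 : ℂ) 1))) := by
    rw [Measure.prod_restrict]
    have hK : IsCompact (Icc 0 (2 * Real.pi) ×ˢ Metric.closedBall (0 : ℂ) 1) :=
      isCompact_Icc.prod (isCompact_closedBall _ _)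
    refine IntegrableOn.mono_set (hcont.continuousOn.integrableOn_compact hK) ?_
    exact prod_mono Ioc_subset_Icc_self Metric.ball_subset_closedBall
  have hswap := integral_integral_swap hint
  have hp : (0 : ℝ) ≤ 2 * Real.pi := by positivity
  simp_rw [hrot, ← intervalIntegral.integral_of_le hp, havg] at hswap
  simp only [intervalIntegral.integral_const, integral_const, sub_zero, Complex.real_smul,
    Measure.real] at hswap
  have h2 : (2 * Real.pi : ℂ) ≠ 0 := by
    exact_mod_cast (by positivity : (2 * Real.pi : ℝ) ≠ 0)
  apply mul_left_cancel₀ h2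
  simp at hswap
  rw [hswap]; ring

theorem pi_mul_norm_sq_le {f : ℂ → ℂ} (hf : Differentiable ℂ f) (w : ℂ) :
    Real.pi * ‖f w‖ ^ 2 ≤ ∫ z in Metric.ball w 1, ‖f z‖ ^ 2 := by
  have hG : Differentiable ℂ fun z => f (w + z) ^ 2 :=
    (hf.comp ((differentiable_const w).add differentiable_id)).pow 2
  have h := congrArg norm (pi_mul_eq_setIntegral hG)
  have h2 := norm_integral_le_integral_norm (μ := volume.restrict (Metric.ball (0 : ℂ) 1))
    fun z => f (w + z) ^ 2
  rw [← h] at h2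
  simp only [add_zero, norm_mul, norm_pow, Complex.norm_real, Real.norm_eq_abs,
    abs_of_pos Real.pi_pos] at h2
  refine h2.trans_eq ?_
  have := (measurePreserving_add_left (volume : Measure ℂ) w).setIntegral_preimage_emb
    (Homeomorph.addLeft w).measurableEmbedding (fun z => ‖f z‖ ^ 2) (Metric.ball w 1)
  rw [← this]
  congr 2
  ext z; simp [dist_eq_norm]

/-- Elements of `F_φ` are bounded on discs by a multiple of their norm. -/
theorem norm_toFun_le (f : FockSpace φ) {R : ℝ≥0} {w : ℂ} (hw : ‖w‖₊ ≤ R) :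
    ‖f.toFun w‖ ≤ Real.exp (φ (R + 1)) * ‖f‖ := by
  refine le_of_sq_le_sq ?_ (by positivity)
  rw [mul_pow, norm_sq_eq, ← Real.exp_nat_mul]
  have h1 := pi_mul_norm_sq_le f.differentiable w
  have h2 : ‖f.toFun w‖ ^ 2 ≤ Real.pi * ‖f.toFun w‖ ^ 2 := by
    have := Real.pi_gt_three
    nlinarith [sq_nonneg ‖f.toFun w‖]
  refine h2.trans (h1.trans ?_)
  have hcont : Continuous fun z => ‖f.toFun z‖ ^ 2 := (f.differentiable.continuous.norm).pow 2
  have hi : IntegrableOn (fun z => ‖f.toFun z‖ ^ 2) (Metric.ball w 1) volume :=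
    (hcont.continuousOn.integrableOn_compact (isCompact_closedBall w 1)).mono_set
      Metric.ball_subset_closedBall
  have h3 : ∫ z in Metric.ball w 1, ‖f.toFun z‖ ^ 2 ≤ ∫ z in Metric.ball w 1,
      Real.exp ((2 : ℕ) * φ (R + 1)) * (‖f.toFun z‖ ^ 2 * Real.exp (-2 * φ ‖z‖₊)) := by
    refine setIntegral_mono_on hi (f.integrable_norm_sq.integrableOn.const_mul _)
      measurableSet_ball fun z hz => ?_
    have hz' : ‖z‖₊ ≤ R + 1 := by
      have h4 : ‖z - w‖ < 1 := by simpa [dist_eq_norm] using hz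
      have h5 : ‖w‖ ≤ R := hw
      have h6 : ‖z‖ ≤ ‖z - w‖ + ‖w‖ := by simpa using norm_add_le (z - w) w
      rw [← NNReal.coe_le_coe]; push_cast; linarith
    have hφ := φ.monotone hz'
    have : 1 ≤ Real.exp ((2 : ℕ) * φ (R + 1)) * Real.exp (-2 * φ ‖z‖₊) := by
      rw [← Real.exp_add]
      apply Real.one_le_exp
      push_cast; linarith
    nlinarith [sq_nonneg ‖f.toFun z‖]
  refine h3.trans ?_
  rw [integral_const_mul]
  refine mul_le_mul_of_nonneg_left ?_ (Real.exp_pos _).le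
  exact setIntegral_le_integral f.integrable_norm_sq (ae_of_all _ fun z => by positivity)

/-- `F_φ` is a Hilbert space of functions with bounded point evaluations. -/
instance : RKHS ℂ (FockSpace φ) ℂ ℂ where
  coeCLM := ContinuousLinearMap.pi fun w =>
    LinearMap.mkContinuous
      { toFun := fun f => f.toFun w, map_add' := fun _ _ => rfl, map_smul' := fun _ _ => rfl }
      (Real.exp (φ (‖w‖₊ + 1))) fun f => f.norm_toFun_le le_rfl
  coeCLM_injective := fun _ _ h => toFun_injective h

theorem coe_eq_toFun (f : FockSpace φ) : ⇑f = f.toFun := rfl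

/-- The isometry `f ↦ f e^{-φ}` into `L²(ℂ)`. -/
def toL2 (f : FockSpace φ) : Lp ℂ 2 (volume : Measure ℂ) := f.memLp_wt.toLp

theorem toL2_sub (f g : FockSpace φ) : (f - g).toL2 = f.toL2 - g.toL2 := by
  rw [toL2, toL2, toL2, ← MemLp.toLp_sub]
  congr 1
  ext z; simp [Fock.wt, toFun_sub, sub_mul]

theorem norm_toL2 (f : FockSpace φ) : ‖f.toL2‖ = ‖f‖ := by
  have h : ‖f.toL2‖ ^ 2 = ‖f‖ ^ 2 := by
    have h1 := inner_self_eq_norm_sq_to_K (𝕜 := ℂ) f.toL2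
    rw [L2.inner_def] at h1
    have h2 : ∫ z : ℂ, ⟪f.toL2 z, f.toL2 z⟫_ℂ
        = ∫ z : ℂ, ((‖f.toFun z‖ ^ 2 * Real.exp (-2 * φ ‖z‖₊) : ℝ) : ℂ) := by
      refine integral_congr_ae ?_
      filter_upwards [f.memLp_wt.coeFn_toLp] with z hz
      rw [toL2, hz, inner_self_eq_norm_sq_to_K, ← Fock.norm_wt_sq]
      push_cast; rfl
    rw [h2, integral_complex_ofReal, ← norm_sq_eq] at h1
    exact Complex.ofReal_injective (by rw [Complex.ofReal_pow]; exact h1.symm)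
  exact (sq_eq_sq₀ (norm_nonneg _) (norm_nonneg _)).1 h

instance : CompleteSpace (FockSpace φ) := by
  refine Metric.complete_of_cauchySeq_tendsto fun u hu => ?_
  have hpt : ∀ (w : ℂ) (m n : ℕ),
      ‖(u m).toFun w - (u n).toFun w‖ ≤ Real.exp (φ (‖w‖₊ + 1)) * ‖u m - u n‖ := by
    intro w m n
    exact (u m - u n).norm_toFun_le le_rfl
  have hcau : ∀ w : ℂ, CauchySeq fun n => (u n).toFun w := by
    intro w
    exact (hu.map ((RKHS.coeCLM ℂ (H := FockSpace φ)).uniformContinuous)).map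
      (Pi.uniformContinuous_proj (fun _ : ℂ => ℂ) w)
  choose g hg using fun w => cauchySeq_tendsto_of_complete (hcau w)
  have hloc : TendstoLocallyUniformlyOn (fun n => (u n).toFun) g atTop univ := by
    rw [tendstoLocallyUniformlyOn_iff_forall_isCompact isOpen_univ]
    intro K _ hK
    obtain ⟨R, hR⟩ := hK.isBounded.exists_norm_le
    have hcu : UniformCauchySeqOn (fun n => (u n).toFun) atTop K := by
      rw [Metric.uniformCauchySeqOn_iff]
      intro ε hε
      set C := Real.exp (φ (R.toNNReal + 1)) with hC
      have hCpos : 0 < C := Real.exp_pos _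
      obtain ⟨N, hN⟩ := Metric.cauchySeq_iff.1 hu (ε / C) (div_pos hε hCpos)
      refine ⟨N, fun m hm n hn z hz => ?_⟩
      have h1 : ‖z‖₊ ≤ R.toNNReal := by
        rw [← NNReal.coe_le_coe, coe_nnnorm]
        exact (hR z hz).trans (Real.le_coe_toNNReal R)
      have h2 := (u m - u n).norm_toFun_le h1
      have h3 := hN m hm n hn
      rw [dist_eq_norm] at h3 ⊢
      refine lt_of_le_of_lt h2 ?_
      rw [← hC]
      calc C * ‖u m - u n‖ < C * (ε / C) := by gcongr
        _ = ε := by field_simp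
    exact hcu.tendstoUniformlyOn_of_tendsto fun z _ => hg z
  have hgd : Differentiable ℂ g := by
    rw [← differentiableOn_univ]
    exact hloc.differentiableOn
      (Eventually.of_forall fun n => (u n).differentiable.differentiableOn) isOpen_univ
  have hL2 : CauchySeq fun n => (u n).toL2 := by
    rw [Metric.cauchySeq_iff] at hu ⊢
    intro ε hε
    obtain ⟨N, hN⟩ := hu ε hε
    refine ⟨N, fun m hm n hn => ?_⟩
    have := hN m hm n hn
    rwa [dist_eq_norm, ← norm_toL2, toL2_sub, ← dist_eq_norm] at this
  obtain ⟨h, hh⟩ := cauchySeq_tendsto_of_complete hL2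
  obtain ⟨ns, hns, hae⟩ := (tendstoInMeasure_of_tendsto_Lp hh).exists_seq_tendsto_ae
  have hae' : Fock.wt φ g =ᵐ[volume] h := by
    have hall : ∀ᵐ z : ℂ, ∀ n, (u n).toL2 z = Fock.wt φ (u n).toFun z :=
      ae_all_iff.2 fun n => (u n).memLp_wt.coeFn_toLp
    filter_upwards [hae, hall] with z hz hz'
    refine tendsto_nhds_unique ?_ hz
    simp_rw [hz']
    exact ((hg z).comp hns.tendsto_atTop).mul_const _
  have hmem : MemLp (Fock.wt φ g) 2 volume := (memLp_congr_ae hae').2 (Lp.memLp h)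
  let G : FockSpace φ := ⟨g, hgd, (Fock.integrable_iff_memLp φ hgd).2 hmem⟩
  have hG : G.toL2 = h := by
    refine Lp.ext ?_
    exact (G.memLp_wt.coeFn_toLp).trans hae'
  refine ⟨G, ?_⟩
  rw [tendsto_iff_norm_sub_tendsto_zero] at hh ⊢
  refine hh.congr fun n => ?_
  rw [← hG, ← toL2_sub, norm_toL2]

/-- The reproducing kernel `k_w` of `F_φ`, given by the Riesz representation of `f ↦ f(w)`. -/
def reproducingKernel (φ : ℝ≥0 →o ℝ) (w : ℂ) : FockSpace φ := RKHS.kerFun (FockSpace φ) w 1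

theorem inner_reproducingKernel (w : ℂ) (f : FockSpace φ) :
    ⟪reproducingKernel φ w, f⟫_ℂ = f w := by
  rw [reproducingKernel, RKHS.kerFun_inner]
  simp

/-- The normalized reproducing kernel `k_w / ‖k_w‖`. -/
def normalizedKernel (φ : ℝ≥0 →o ℝ) (w : ℂ) : FockSpace φ :=
  ((‖reproducingKernel φ w‖⁻¹ : ℝ) : ℂ) • reproducingKernel φ w

/-- `Λ` is a complete interpolating sequence for `F_φ`: for each `a ∈ ℓ²`, the problem
`f(Λ i) / ‖k_{Λ i}‖ = a i` for all `i` has a unique solution in `F_φ`. -/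
def IsCompleteInterpolating {ι : Type*} (φ : ℝ≥0 →o ℝ) (Λ : ι → ℂ) : Prop :=
  ∀ a : lp (fun _ : ι => ℂ) 2, ∃! f : FockSpace φ,
    ∀ i, f (Λ i) / (‖reproducingKernel φ (Λ i)‖ : ℂ) = a i

end FockSpace

/-- A family of vectors is a Riesz basis if it is complete (its linear span is dense) and
`c ∑ |a i|² ≤ ‖∑ a i • v i‖² ≤ C ∑ |a i|²` for all finitely supported `a`, with `c, C > 0`. -/
def IsRieszBasis {ι H : Type*} [NormedAddCommGroup H] [InnerProductSpace ℂ H] (v : ι → H) : Prop :=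
  (Submodule.span ℂ (range v)).topologicalClosure = ⊤ ∧
    ∃ c C : ℝ, 0 < c ∧ 0 < C ∧ ∀ (s : Finset ι) (a : ι → ℂ),
      c * ∑ i ∈ s, ‖a i‖ ^ 2 ≤ ‖∑ i ∈ s, a i • v i‖ ^ 2 ∧
      ‖∑ i ∈ s, a i • v i‖ ^ 2 ≤ C * ∑ i ∈ s, ‖a i‖ ^ 2

/-- The weight `φ(r) = (log⁺ r)²`. -/
def logPlusSq : ℝ≥0 →o ℝ where
  toFun r := Real.posLog r ^ 2
  monotone' r _ h := pow_le_pow_left₀ Real.posLog_nonneg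
    (Real.posLog_le_posLog r.coe_nonneg (NNReal.coe_le_coe.2 h)) 2

end

/-!
Write `φ(r) = (log⁺ r)²`, `t = log |z|` and `a n = (n + 1) / 2`, so that the nodes satisfy
`|λ n| = exp (a n)`. Only these moduli matter; the arguments of the nodes are arbitrary.

The family of normalized kernels is a Riesz basis, and the nodes are completely interpolating, as
soon as three facts hold: the Bessel inequality `∑ |f(λ n)|² / ‖k_{λ n}‖² ≤ B ‖f‖²`, the solution of
finite interpolation problems `f(λ n) / ‖k_{λ n}‖ = b n` with `‖f‖² ≤ C ∑ |b n|²` uniformly in the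
number of nodes, and uniqueness. The first gives the upper Riesz bound by duality
(`RieszBasis.norm_sum_smul_sq_le`), the second the lower one (`RieszBasis.le_norm_sum_smul_sq`), the
third density of the span. The lower bound makes `T T†` coercive for the analysis operator `T` into
`ℓ²`, so `T` is onto (`RieszBasis.exists_inner_eq`).

* Bessel inequality. On the disc of centre `w` and radius `|w| / 5` the weight is, up to a constant
  factor, `|z|` to an integer power, so dividing by a power of `z` reduces the weighted area mean
  value inequality to the classical one (`FockSpace.exists_norm_sq_le`). This gives
  `|f(w)| ≤ C exp (t² - t) ‖f‖`; testing with monomials shows that `‖k_w‖` has this order at the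
  nodes. The discs around the nodes are disjoint, and summation gives the Bessel inequality.

* Finite interpolation. Since `log |λ k|` runs through an arithmetic progression, products
  `∏ |1 - z / λ k|` are comparable to `∏ max 1 |z / λ k|`, away from the circles through the nodes
  for the lower bound, and the latter is at most a constant times `exp (t² - t / 2)`. Multiplied by
  `‖k_{λ n}‖`, the Lagrange polynomial at `λ n` satisfies
  `|z| e^{-φ(|z|)} |G n z| ≤ C exp (-|t - a n| / 2)`, uniformly in the number of nodes
  (`FockSpace.exists_lagrange_le`). The norm bound follows from the Cauchy–Schwarz inequality, since
  `|z|⁻² exp (-|t - a n| / 2)` has an integral independent of `n`.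

* Uniqueness. If `f` vanishes at all nodes, divide it by the product over the first `K` of them. On
  the circle halfway between two consecutive moduli the quotient is `O (exp (-K / 4))`, and the
  maximum principle forces `f = 0` (`FockSpace.eq_zero_of_forall_eq_zero`).
-/

/-! ### Riesz bases from Bessel, interpolation and uniqueness -/

namespace RieszBasis

variable {ι H : Type*} [NormedAddCommGroup H] [InnerProductSpace ℂ H] {v : ι → H}

/-- The upper Riesz bound, dual to the Bessel inequality. -/
theorem norm_sum_smul_sq_le {B : ℝ} (hB0 : 0 ≤ B)
    (hB : ∀ (f : H) (s : Finset ι), ∑ i ∈ s, ‖⟪v i, f⟫_ℂ‖ ^ 2 ≤ B * ‖f‖ ^ 2)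
    (s : Finset ι) (a : ι → ℂ) :
    ‖∑ i ∈ s, a i • v i‖ ^ 2 ≤ B * ∑ i ∈ s, ‖a i‖ ^ 2 := by
  set u := ∑ i ∈ s, a i • v i with hu
  have h1 : ‖u‖ ^ 2 ≤ ∑ i ∈ s, ‖a i‖ * ‖⟪v i, u⟫_ℂ‖ := by
    have h : ‖⟪u, u⟫_ℂ‖ = ‖u‖ ^ 2 := by rw [inner_self_eq_norm_sq_to_K]; simp
    rw [← h]
    nth_rewrite 1 [hu]
    rw [sum_inner]
    refine (norm_sum_le _ _).trans (Finset.sum_le_sum fun i _ => ?_)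
    rw [inner_smul_left, norm_mul, RCLike.norm_conj]
  have h2 : (∑ i ∈ s, ‖a i‖ * ‖⟪v i, u⟫_ℂ‖) ^ 2 ≤
      (∑ i ∈ s, ‖a i‖ ^ 2) * ∑ i ∈ s, ‖⟪v i, u⟫_ℂ‖ ^ 2 := Finset.sum_mul_sq_le_sq_mul_sq _ _ _
  have hA : 0 ≤ ∑ i ∈ s, ‖a i‖ ^ 2 := Finset.sum_nonneg fun i _ => by positivity
  have h4 : (‖u‖ ^ 2) ^ 2 ≤ (B * ∑ i ∈ s, ‖a i‖ ^ 2) * ‖u‖ ^ 2 := by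
    calc (‖u‖ ^ 2) ^ 2 ≤ (∑ i ∈ s, ‖a i‖ * ‖⟪v i, u⟫_ℂ‖) ^ 2 := by gcongr
      _ ≤ _ := h2
      _ ≤ (∑ i ∈ s, ‖a i‖ ^ 2) * (B * ‖u‖ ^ 2) := by gcongr; exact hB u s
      _ = _ := by ring
  rcases eq_or_ne (‖u‖ ^ 2) 0 with h0 | h0
  · rw [h0]; positivity
  · have hp : 0 < ‖u‖ ^ 2 := lt_of_le_of_ne (by positivity) (Ne.symm h0)
    rw [sq (‖u‖ ^ 2)] at h4
    exact le_of_mul_le_mul_right h4 hp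

/-- The lower Riesz bound, dual to the solution of finite interpolation problems with norm
control. -/
theorem le_norm_sum_smul_sq {C : ℝ} (hC0 : 0 < C)
    (hI : ∀ (s : Finset ι) (a : ι → ℂ), ∃ f : H, (∀ i ∈ s, ⟪v i, f⟫_ℂ = a i) ∧
      ‖f‖ ^ 2 ≤ C * ∑ i ∈ s, ‖a i‖ ^ 2)
    (s : Finset ι) (a : ι → ℂ) :
    C⁻¹ * ∑ i ∈ s, ‖a i‖ ^ 2 ≤ ‖∑ i ∈ s, a i • v i‖ ^ 2 := by
  obtain ⟨f, hf, hn⟩ := hI s a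
  set u := ∑ i ∈ s, a i • v i with hu
  set A := ∑ i ∈ s, ‖a i‖ ^ 2 with hA
  have hA0 : 0 ≤ A := Finset.sum_nonneg fun i _ => by positivity
  have h1 : ⟪u, f⟫_ℂ = (A : ℂ) := by
    rw [hu, sum_inner, hA]
    push_cast
    refine Finset.sum_congr rfl fun i hi => ?_
    rw [inner_smul_left, hf i hi, Complex.conj_mul']
  have h2 : A ≤ ‖u‖ * ‖f‖ := by
    have := norm_inner_le_norm (𝕜 := ℂ) u f
    rwa [h1, Complex.norm_real, Real.norm_eq_abs, abs_of_nonneg hA0] at this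
  have h3 : A ^ 2 ≤ ‖u‖ ^ 2 * (C * A) := by
    calc A ^ 2 ≤ (‖u‖ * ‖f‖) ^ 2 := by gcongr
      _ = ‖u‖ ^ 2 * ‖f‖ ^ 2 := by ring
      _ ≤ _ := by gcongr
  rw [inv_mul_le_iff₀ hC0]
  rcases eq_or_lt_of_le hA0 with h0 | h0
  · rw [← h0]; positivity
  · refine le_of_mul_le_mul_right ?_ h0
    calc A * A = A ^ 2 := by ring
      _ ≤ _ := h3
      _ = _ := by ring

variable [CompleteSpace H]

theorem dense_span (hU : ∀ f : H, (∀ i, ⟪v i, f⟫_ℂ = 0) → f = 0) :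
    (Submodule.span ℂ (range v)).topologicalClosure = ⊤ := by
  rw [Submodule.topologicalClosure_eq_top_iff, eq_bot_iff]
  intro f hf
  refine hU f fun i => ?_
  exact (Submodule.mem_orthogonal _ _).1 hf _ (Submodule.subset_span ⟨i, rfl⟩)

/-- If `T f = (⟪v i, f⟫)` is bounded from `H` to `ℓ²`, then the lower Riesz bound says that the
adjoint of `T` is bounded below, so that `T T†` is coercive, hence invertible, and `T` is onto. -/
theorem exists_inner_eq {B C : ℝ} (hB0 : 0 ≤ B) (hC0 : 0 < C)
    (hB : ∀ (f : H) (s : Finset ι), ∑ i ∈ s, ‖⟪v i, f⟫_ℂ‖ ^ 2 ≤ B * ‖f‖ ^ 2)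
    (hL : ∀ (s : Finset ι) (a : ι → ℂ),
      C * ∑ i ∈ s, ‖a i‖ ^ 2 ≤ ‖∑ i ∈ s, a i • v i‖ ^ 2)
    (a : lp (fun _ : ι => ℂ) 2) : ∃ f : H, ∀ i, ⟪v i, f⟫_ℂ = a i := by
  classical
  have hmem : ∀ f : H, Memℓp (fun i => ⟪v i, f⟫_ℂ) 2 := fun f =>
    memℓp_gen' (C := B * ‖f‖ ^ 2) fun s => by simpa using hB f s
  let T₀ : H →ₗ[ℂ] lp (fun _ : ι => ℂ) 2 :=
    { toFun := fun f => ⟨fun i => ⟪v i, f⟫_ℂ, hmem f⟩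
      map_add' := fun f g => by ext i; exact inner_add_right _ _ _
      map_smul' := fun c f => by ext i; exact inner_smul_right _ _ _ }
  let T : H →L[ℂ] lp (fun _ : ι => ℂ) 2 := T₀.mkContinuous (√B) fun f => by
    refine lp.norm_le_of_forall_sum_le (p := 2) (by norm_num) (by positivity) fun s => ?_
    have h := hB f s
    have h2 : (√B * ‖f‖) ^ 2 = B * ‖f‖ ^ 2 := by rw [mul_pow, Real.sq_sqrt hB0]
    have h3 : ∀ i, ‖(T₀ f : ∀ _ : ι, ℂ) i‖ = ‖⟪v i, f⟫_ℂ‖ := fun i => rfl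
    simpa [h2, h3] using h
  have hT : ∀ f i, T f i = ⟪v i, f⟫_ℂ := fun f i => rfl
  let S := ContinuousLinearMap.adjoint T
  have hS : ∀ i (c : ℂ), S (lp.single 2 i c) = c • v i := by
    intro i c
    refine ext_inner_right ℂ fun f => ?_
    rw [ContinuousLinearMap.adjoint_inner_left, lp.inner_single_left, hT, inner_smul_left]
    simp [mul_comm]
  have hS2 : ∀ b : lp (fun _ : ι => ℂ) 2, C * ‖b‖ ^ 2 ≤ ‖S b‖ ^ 2 := by
    intro b
    have hb := lp.hasSum_single (p := 2) (by norm_num) b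
    have hl : Tendsto (fun s : Finset ι => C * ‖∑ i ∈ s, lp.single 2 i (b i)‖ ^ 2) atTop
        (𝓝 (C * ‖b‖ ^ 2)) := (hb.norm.pow 2).const_mul C
    have hr : Tendsto (fun s : Finset ι => ‖S (∑ i ∈ s, lp.single 2 i (b i))‖ ^ 2) atTop
        (𝓝 (‖S b‖ ^ 2)) := (((S.continuous.tendsto b).comp hb).norm).pow 2
    refine le_of_tendsto_of_tendsto' hl hr fun s => ?_
    rw [map_sum]
    simp_rw [hS]
    have hn : ‖∑ i ∈ s, lp.single (E := fun _ : ι => ℂ) 2 i (b i)‖ ^ 2 = ∑ i ∈ s, ‖b i‖ ^ 2 := by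
      have := lp.norm_sum_single (E := fun _ : ι => ℂ) (p := 2) (by norm_num) b s
      simpa using this
    rw [hn]
    exact hL s b
  have hunit : IsUnit (T ∘L S) := by
    refine ContinuousLinearMap.isUnit_of_forall_le_norm_inner_map _ (c := ⟨C, hC0.le⟩) hC0
      fun b => ?_
    have h : ⟪(T ∘L S) b, b⟫_ℂ = ((‖S b‖ ^ 2 : ℝ) : ℂ) := by
      rw [ContinuousLinearMap.comp_apply, ← ContinuousLinearMap.adjoint_inner_right]
      rw [inner_self_eq_norm_sq_to_K]; push_cast; rfl
    rw [h, Complex.norm_real, Real.norm_eq_abs, abs_of_nonneg (by positivity), mul_comm]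
    exact hS2 b
  obtain ⟨U, hU⟩ := hunit
  refine ⟨S ((↑U⁻¹ : lp (fun _ : ι => ℂ) 2 →L[ℂ] lp (fun _ : ι => ℂ) 2) a), fun i => ?_⟩
  have h : (T ∘L S) ((↑U⁻¹ : lp (fun _ : ι => ℂ) 2 →L[ℂ] lp (fun _ : ι => ℂ) 2) a) = a := by
    rw [← hU, ← mul_apply_eq_comp, U.mul_inv]; rfl
  rw [← hT]
  exact congrArg (fun b : lp (fun _ : ι => ℂ) 2 => b i) h

end RieszBasis

/-! ### Products over a geometric progression of moduli -/

namespace GeometricNodes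

/-- Sums of `exp (-α |t - (k+1)/2|)` are bounded uniformly in `t`, because the points `(k+1)/2`
are uniformly separated. -/
theorem exists_sum_exp_le {α : ℝ} (hα : 0 < α) :
    ∃ C : ℝ, 0 < C ∧ ∀ (t : ℝ) (s : Finset ℕ),
      ∑ k ∈ s, Real.exp (-α * |t - ((k : ℝ) + 1) / 2|) ≤ C := by
  have hs : Summable fun n : ℕ => Real.exp (n * (-α / 2)) :=
    Real.summable_exp_nat_mul_iff.2 (by linarith)
  have hs2 : Summable fun j : ℤ => Real.exp (-α / 2 * |(j : ℝ)|) := by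
    refine Summable.of_nat_of_neg (hs.congr fun n => ?_) (hs.congr fun n => ?_)
    · simp [mul_comm]
    · simp [mul_comm]
  set D := ∑' j : ℤ, Real.exp (-α / 2 * |(j : ℝ)|) with hD
  have hD0 : 0 ≤ D := tsum_nonneg fun j => (Real.exp_pos _).le
  refine ⟨Real.exp (α / 2) * D + 1, by positivity, fun t s => ?_⟩
  -- `⌊2 t⌋` numbers the half-integer just below `t`, so `|e k| ≤ 2 |t - (k+1)/2| + 1`.
  let e : ℕ → ℤ := fun k => (k : ℤ) + 1 - ⌊2 * t⌋
  have he : Function.Injective e := fun a b h => by simpa [e] using h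
  have h1 : ∀ k ∈ s, Real.exp (-α * |t - ((k : ℝ) + 1) / 2|) ≤
      Real.exp (α / 2) * Real.exp (-α / 2 * |((e k : ℤ) : ℝ)|) := by
    intro k _
    rw [← Real.exp_add]
    apply Real.exp_le_exp.2
    have h2 : |((e k : ℤ) : ℝ)| ≤ 2 * |t - ((k : ℝ) + 1) / 2| + 1 := by
      have h3 := Int.floor_le (2 * t)
      have h4 := Int.lt_floor_add_one (2 * t)
      have h5 := le_abs_self (t - ((k : ℝ) + 1) / 2)
      have h6 := neg_abs_le (t - ((k : ℝ) + 1) / 2)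
      simp only [e]
      push_cast
      rw [abs_le]
      constructor <;> linarith
    nlinarith
  calc ∑ k ∈ s, Real.exp (-α * |t - ((k : ℝ) + 1) / 2|)
      ≤ ∑ k ∈ s, Real.exp (α / 2) * Real.exp (-α / 2 * |((e k : ℤ) : ℝ)|) :=
        Finset.sum_le_sum h1
    _ = Real.exp (α / 2) * ∑ j ∈ s.map ⟨e, he⟩, Real.exp (-α / 2 * |(j : ℝ)|) := by
        rw [← Finset.mul_sum, Finset.sum_map]; rfl
    _ ≤ Real.exp (α / 2) * D := by
        gcongr
        exact hs2.sum_le_tsum _ fun j _ => (Real.exp_pos _).le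
    _ ≤ _ := by linarith

/-- `1 + exp x` is at most `max 1 (exp x)` up to a factor whose logarithm `exp (-|x|)` is summable
over separated points `x`. -/
theorem one_add_exp_le (x : ℝ) :
    1 + Real.exp x ≤ Real.exp (max 0 x) * Real.exp (Real.exp (-|x|)) := by
  have h := Real.add_one_le_exp (Real.exp (-|x|))
  rcases le_total 0 x with hx | hx
  · rw [max_eq_right hx]
    rw [abs_of_nonneg hx] at h ⊢
    have h2 : 1 + Real.exp x = Real.exp x * (Real.exp (-x) + 1) := by
      rw [mul_add, ← Real.exp_add]; simp
    rw [h2]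
    gcongr
  · rw [max_eq_left hx, Real.exp_zero, one_mul]
    rw [abs_of_nonpos hx, neg_neg] at h ⊢
    linarith

/-- The lower counterpart of `one_add_exp_le`, from `1 - y ≥ exp (-y / (1 - y))` for
`y = exp (-|x|) ≤ exp (-1 / 4)`. -/
theorem le_abs_one_sub_exp {x : ℝ} (hx : 1 / 4 ≤ |x|) :
    Real.exp (max 0 x) * Real.exp (-(1 - Real.exp (-(1 / 4)))⁻¹ * Real.exp (-|x|)) ≤
      |1 - Real.exp x| := by
  have hq : Real.exp (-(1 / 4)) < 1 := Real.exp_lt_one_iff.2 (by norm_num)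
  have key : Real.exp (-(1 - Real.exp (-(1 / 4)))⁻¹ * Real.exp (-|x|)) ≤ 1 - Real.exp (-|x|) := by
    set y := Real.exp (-|x|) with hy
    have hy0 : 0 < y := Real.exp_pos _
    have hyq : y ≤ Real.exp (-(1 / 4)) := Real.exp_le_exp.2 (by linarith)
    have hp : 0 < 1 - y := by linarith
    have h1 : (1 - y)⁻¹ ≤ Real.exp (y / (1 - y)) := by
      have := Real.add_one_le_exp (y / (1 - y))
      have h2 : y / (1 - y) + 1 = (1 - y)⁻¹ := by field_simp; ring
      linarith
    have h3 : Real.exp (-(y / (1 - y))) ≤ 1 - y := by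
      rw [Real.exp_neg]
      exact inv_le_of_inv_le₀ hp h1
    refine le_trans (Real.exp_le_exp.2 ?_) h3
    rw [neg_mul, neg_le_neg_iff, div_eq_inv_mul]
    gcongr
  rcases le_total 0 x with h0 | h0
  · rw [max_eq_right h0]
    rw [abs_of_nonneg h0] at key ⊢
    have h2 : Real.exp x - 1 = Real.exp x * (1 - Real.exp (-x)) := by
      rw [mul_sub, ← Real.exp_add]; simp
    rw [abs_of_nonpos (by have := Real.one_le_exp h0; linarith), neg_sub, h2]
    gcongr
  · rw [max_eq_left h0, Real.exp_zero, one_mul]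
    rw [abs_of_nonpos h0, neg_neg] at key ⊢
    rw [abs_of_nonneg (by have := Real.exp_le_one_iff.2 h0; linarith)]
    exact key

/-- The maximum of `0` and of the logarithm of `|z / λ|`, where `log |z| = t` and
`log |λ| = (k + 1) / 2`. -/
noncomputable def excess (t : ℝ) (k : ℕ) : ℝ := max 0 (t - ((k : ℝ) + 1) / 2)

theorem excess_nonneg (t : ℝ) (k : ℕ) : 0 ≤ excess t k := le_max_left _ _

theorem exists_prod_one_add_le : ∃ C : ℝ, 0 < C ∧ ∀ (t : ℝ) (s : Finset ℕ),
    ∏ k ∈ s, (1 + Real.exp (t - ((k : ℝ) + 1) / 2)) ≤ C * Real.exp (∑ k ∈ s, excess t k) := by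
  obtain ⟨C, -, hC⟩ := exists_sum_exp_le (α := 1) one_pos
  refine ⟨Real.exp C, Real.exp_pos _, fun t s => ?_⟩
  calc ∏ k ∈ s, (1 + Real.exp (t - ((k : ℝ) + 1) / 2))
      ≤ ∏ k ∈ s, Real.exp (excess t k) * Real.exp (Real.exp (-|t - ((k : ℝ) + 1) / 2|)) :=
        Finset.prod_le_prod (fun k _ => by positivity) fun k _ => one_add_exp_le _
    _ = Real.exp (∑ k ∈ s, excess t k) *
        Real.exp (∑ k ∈ s, Real.exp (-|t - ((k : ℝ) + 1) / 2|)) := by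
        rw [Finset.prod_mul_distrib, Real.exp_sum, Real.exp_sum]
    _ ≤ Real.exp (∑ k ∈ s, excess t k) * Real.exp C := by
        gcongr
        simpa using hC t s
    _ = _ := mul_comm _ _

theorem exists_le_prod_abs_one_sub : ∃ c : ℝ, 0 < c ∧ ∀ (t : ℝ) (s : Finset ℕ),
    (∀ k ∈ s, 1 / 4 ≤ |t - ((k : ℝ) + 1) / 2|) →
    c * Real.exp (∑ k ∈ s, excess t k) ≤ ∏ k ∈ s, |1 - Real.exp (t - ((k : ℝ) + 1) / 2)| := by
  obtain ⟨C, -, hC⟩ := exists_sum_exp_le (α := 1) one_pos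
  have hq : Real.exp (-(1 / 4)) < 1 := Real.exp_lt_one_iff.2 (by norm_num)
  set κ := (1 - Real.exp (-(1 / 4)))⁻¹ with hκ
  have hκ0 : 0 < κ := inv_pos.2 (by linarith)
  refine ⟨Real.exp (-κ * C), Real.exp_pos _, fun t s hs => ?_⟩
  calc Real.exp (-κ * C) * Real.exp (∑ k ∈ s, excess t k)
      ≤ Real.exp (-κ * ∑ k ∈ s, Real.exp (-|t - ((k : ℝ) + 1) / 2|)) *
          Real.exp (∑ k ∈ s, excess t k) := by
        gcongr Real.exp ?_ * _
        rw [neg_mul, neg_mul, neg_le_neg_iff]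
        gcongr
        simpa using hC t s
    _ = ∏ k ∈ s, Real.exp (excess t k) *
          Real.exp (-κ * Real.exp (-|t - ((k : ℝ) + 1) / 2|)) := by
        rw [Finset.prod_mul_distrib, Finset.mul_sum, Real.exp_sum, Real.exp_sum, mul_comm]
    _ ≤ _ := Finset.prod_le_prod (fun k _ => by positivity) fun k hk =>
        le_abs_one_sub_exp (hs k hk)

theorem sum_excess_eq_zero {t : ℝ} (ht : t ≤ 0) (s : Finset ℕ) : ∑ k ∈ s, excess t k = 0 := by
  refine Finset.sum_eq_zero fun k _ => max_eq_left ?_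
  have : (0 : ℝ) ≤ k := k.cast_nonneg
  linarith

/-- Up to a constant, `t ^ 2 - t / 2` bounds the logarithm of the product of all `|z / λ|` over the
nodes with `|λ| < |z| = e ^ t`; the constant `1 / 16` is the one reproduced by the induction, which
shifts `t` by `1 / 2`. -/
theorem sum_excess_le (K : ℕ) {t : ℝ} (ht : 0 ≤ t) :
    ∑ k ∈ Finset.range K, excess t k ≤ t ^ 2 - t / 2 + 1 / 16 := by
  induction K generalizing t with
  | zero => simp; nlinarith [sq_nonneg (t - 1 / 4)]
  | succ K ih =>
    rw [Finset.sum_range_succ']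
    have hshift : ∀ k : ℕ, excess t (k + 1) = excess (t - 1 / 2) k := by
      intro k; simp only [excess]; push_cast; congr 1; ring
    simp_rw [hshift]
    rcases le_total (1 / 2) t with h | h
    · have h1 := ih (t := t - 1 / 2) (by linarith)
      have h2 : excess t 0 = t - 1 / 2 := by
        simp only [excess]; rw [max_eq_right] <;> norm_num; linarith
      rw [h2]
      nlinarith
    · rw [sum_excess_eq_zero (by linarith)]
      have h2 : excess t 0 = 0 := by
        simp only [excess]; rw [max_eq_left]; norm_num; linarith
      rw [h2]
      nlinarith [sq_nonneg (t - 1 / 4)]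

theorem le_sum_excess {m K : ℕ} (h : m ≤ K) (t : ℝ) :
    m * t - m * (m + 1) / 4 ≤ ∑ k ∈ Finset.range K, excess t k := by
  have h1 : ∑ k ∈ Finset.range m, (t - ((k : ℝ) + 1) / 2) = m * t - m * (m + 1) / 4 := by
    clear h
    induction m with
    | zero => simp
    | succ m ih => rw [Finset.sum_range_succ, ih]; push_cast; ring
  rw [← h1]
  calc ∑ k ∈ Finset.range m, (t - ((k : ℝ) + 1) / 2)
      ≤ ∑ k ∈ Finset.range m, excess t k := Finset.sum_le_sum fun k _ => le_max_right _ _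
    _ ≤ _ := Finset.sum_le_sum_of_subset_of_nonneg (by simpa using h)
        fun k _ _ => excess_nonneg _ _

end GeometricNodes

/-! ### Radial bumps around circles -/

/-- The function `|z|⁻² exp (-|log |z| - c| / 2)`, an integrable bump around the circle of radius
`exp c`. -/
noncomputable def radialBump (c : ℝ) (z : ℂ) : ℝ :=
  (‖z‖ ^ 2)⁻¹ * Real.exp (-|Real.log ‖z‖ - c| / 2)

namespace radialBump

theorem nonneg (c : ℝ) (z : ℂ) : 0 ≤ radialBump c z := by unfold radialBump; positivity

theorem integrable_zero : Integrable (radialBump 0) := by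
  have h := (integrable_fun_norm_addHaar (volume : Measure ℂ)
    (f := fun r : ℝ => (r ^ 2)⁻¹ * Real.exp (-|Real.log r - 0| / 2))).2
  refine h ?_
  rw [Complex.finrank_real_complex, ← Ioc_union_Ioi_eq_Ioi (zero_le_one (α := ℝ))]
  refine IntegrableOn.union ?_ ?_
  · have h1 : IntegrableOn (fun r : ℝ => r ^ (-(1 / 2) : ℝ)) (Ioc 0 1) := by
      rw [← intervalIntegrable_iff_integrableOn_Ioc_of_le zero_le_one]
      exact intervalIntegral.intervalIntegrable_rpow' (by norm_num)
    refine h1.congr_fun (fun r hr => ?_) measurableSet_Ioc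
    have hr0 : 0 < r := hr.1
    have hl : Real.log r ≤ 0 := Real.log_nonpos hr0.le hr.2
    simp only [sub_zero, abs_of_nonpos hl, smul_eq_mul, Real.rpow_def_of_pos hr0]
    have h3 : Real.exp (- -Real.log r / 2) = r * Real.exp (Real.log r * (-(1 / 2))) := by
      conv_rhs => rw [← Real.exp_log hr0, ← Real.exp_add, Real.exp_log hr0]
      congr 1; ring
    rw [h3]
    field_simp
    norm_num
  · have h1 : IntegrableOn (fun r : ℝ => r ^ (-(3 / 2) : ℝ)) (Ioi 1) :=
      integrableOn_Ioi_rpow_of_lt (by norm_num) one_pos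
    refine h1.congr_fun (fun r hr => ?_) measurableSet_Ioi
    have hr0 : 0 < r := one_pos.trans hr
    have hl : 0 ≤ Real.log r := Real.log_nonneg (le_of_lt hr)
    simp only [sub_zero, abs_of_nonneg hl, smul_eq_mul, Real.rpow_def_of_pos hr0]
    have h3 : Real.exp (-Real.log r / 2) = r * Real.exp (Real.log r * (-(3 / 2))) := by
      conv_rhs => rw [← Real.exp_log hr0, ← Real.exp_add, Real.exp_log hr0]
      congr 1; ring
    rw [h3]
    field_simp
    norm_num

theorem eq_scale (c : ℝ) : radialBump c =
    fun z => Real.exp (-2 * c) * radialBump 0 (Real.exp (-c) • z) := by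
  ext z
  rcases eq_or_ne z 0 with rfl | hz
  · simp [radialBump]
  · have hz' : 0 < ‖z‖ := norm_pos_iff.2 hz
    simp only [radialBump, norm_smul, Real.norm_eq_abs, Real.abs_exp]
    rw [Real.log_mul (Real.exp_pos _).ne' hz'.ne', Real.log_exp]
    have h1 : -c + Real.log ‖z‖ - 0 = Real.log ‖z‖ - c := by ring
    have h2 : Real.exp (-2 * c) = Real.exp (-c) ^ 2 := by
      rw [← Real.exp_nat_mul]; congr 1; push_cast; ring
    rw [h1, h2]
    field_simp

theorem integrable (c : ℝ) : Integrable (radialBump c) := by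
  rw [eq_scale]
  exact (integrable_zero.comp_smul (Real.exp_pos _).ne').const_mul _

theorem integral_eq (c : ℝ) : ∫ z, radialBump c z = ∫ z, radialBump 0 z := by
  rw [eq_scale, integral_const_mul, Measure.integral_comp_smul, Complex.finrank_real_complex,
    smul_eq_mul, ← mul_assoc]
  have : Real.exp (-2 * c) * |(Real.exp (-c) ^ 2)⁻¹| = 1 := by
    rw [abs_of_pos (by positivity), ← Real.exp_nat_mul, ← Real.exp_neg, ← Real.exp_add]
    rw [Real.exp_eq_one_iff]; push_cast; ring
  rw [this, one_mul]

end radialBump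

/-! ### The area mean value inequality on discs -/

/-- The area mean value property on the unit disc, obtained by averaging over rotations. -/
theorem pi_mul_eq_setIntegral_ball {G : ℂ → ℂ} (hG : DiffContOnCl ℂ G (Metric.ball 0 1)) :
    (Real.pi : ℂ) * G 0 = ∫ z in Metric.ball (0 : ℂ) 1, G z := by
  have hrot : ∀ t : ℝ, ∫ z in Metric.ball (0 : ℂ) 1, G (circleMap 0 1 t * z)
      = ∫ z in Metric.ball (0 : ℂ) 1, G z := by
    intro t
    set c : Circle := Circle.exp t
    have hc : circleMap 0 1 t = (c : ℂ) := by simp [circleMap, c, Circle.coe_exp]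
    have := (rotation c).measurePreserving.setIntegral_preimage_emb
      (rotation c).toHomeomorph.measurableEmbedding G (Metric.ball (0 : ℂ) 1)
    rw [← this, hc]
    have hpre : (rotation c) ⁻¹' Metric.ball (0 : ℂ) 1 = Metric.ball (0 : ℂ) 1 := by
      ext z; simp only [mem_preimage, mem_ball_zero_iff, LinearIsometryEquiv.norm_map]
    rw [hpre]
    simp [rotation_apply]
  have havg : ∀ z ∈ Metric.ball (0 : ℂ) 1,
      ∫ t in (0 : ℝ)..2 * Real.pi, G (circleMap 0 1 t * z) = 2 * Real.pi * G 0 := by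
    intro z hz
    have hz' : ‖z‖ < 1 := by simpa using hz
    have hmaps : MapsTo (fun c : ℂ => c * z) (Metric.ball 0 |1|) (Metric.ball 0 1) := by
      intro c hc
      have hc' : ‖c‖ < 1 := by simpa using hc
      simp only [mem_ball_zero_iff, norm_mul]
      nlinarith [norm_nonneg z, norm_nonneg c]
    have h : DiffContOnCl ℂ (fun c : ℂ => G (c * z)) (Metric.ball 0 |1|) :=
      hG.comp (differentiable_id.mul_const z).diffContOnCl hmaps
    have := h.circleAverage
    rw [Real.circleAverage_def, zero_mul] at this
    rw [← this, Complex.real_smul]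
    have := Real.pi_ne_zero
    push_cast
    rw [← mul_assoc, mul_inv_cancel₀, one_mul]
    exact_mod_cast mul_ne_zero two_ne_zero this
  have hGc : ContinuousOn G (Metric.closedBall 0 1) := hG.continuousOn_ball
  have hcont : ContinuousOn (fun p : ℝ × ℂ => G (circleMap 0 1 p.1 * p.2))
      (Icc 0 (2 * Real.pi) ×ˢ Metric.closedBall (0 : ℂ) 1) := by
    refine hGc.comp (((continuous_circleMap 0 1).comp continuous_fst).mul
      continuous_snd).continuousOn fun p hp => ?_
    have : ‖p.2‖ ≤ 1 := by simpa using hp.2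
    simpa using this
  have hint : Integrable (Function.uncurry fun (t : ℝ) (z : ℂ) => G (circleMap 0 1 t * z))
      ((volume.restrict (Ioc 0 (2 * Real.pi))).prod
        (volume.restrict (Metric.ball (0 : ℂ) 1))) := by
    rw [Measure.prod_restrict]
    have hK : IsCompact (Icc 0 (2 * Real.pi) ×ˢ Metric.closedBall (0 : ℂ) 1) :=
      isCompact_Icc.prod (isCompact_closedBall _ _)
    refine IntegrableOn.mono_set (hcont.integrableOn_compact hK) ?_
    exact prod_mono Ioc_subset_Icc_self Metric.ball_subset_closedBall
  have hswap := integral_integral_swap hint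
  have hp : (0 : ℝ) ≤ 2 * Real.pi := by positivity
  simp_rw [hrot, ← intervalIntegral.integral_of_le hp] at hswap
  rw [setIntegral_congr_fun measurableSet_ball havg] at hswap
  simp only [intervalIntegral.integral_const, integral_const, sub_zero, Complex.real_smul,
    Measure.real] at hswap
  have h2 : (2 * Real.pi : ℂ) ≠ 0 := by
    exact_mod_cast (by positivity : (2 * Real.pi : ℝ) ≠ 0)
  apply mul_left_cancel₀ h2
  simp at hswap
  rw [hswap]; ring

open scoped Pointwise in
theorem pi_mul_sq_mul_norm_sq_le {g : ℂ → ℂ} {w : ℂ} {ρ : ℝ} (hρ : 0 < ρ)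
    (hg : DiffContOnCl ℂ g (Metric.ball w ρ)) :
    Real.pi * ρ ^ 2 * ‖g w‖ ^ 2 ≤ ∫ z in Metric.ball w ρ, ‖g z‖ ^ 2 := by
  have hmaps : MapsTo (fun z : ℂ => w + ρ * z) (Metric.ball 0 1) (Metric.ball w ρ) := by
    intro z hz
    have hz' : ‖z‖ < 1 := by simpa using hz
    simp only [Metric.mem_ball, dist_eq_norm, add_sub_cancel_left, norm_mul, Complex.norm_real,
      Real.norm_eq_abs, abs_of_pos hρ]
    nlinarith
  have haff : Differentiable ℂ fun z : ℂ => w + ρ * z :=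
    (differentiable_const w).add (differentiable_id.const_mul (ρ : ℂ))
  have hc := hg.comp haff.diffContOnCl hmaps
  have hG : DiffContOnCl ℂ (fun z => g (w + ρ * z) ^ 2) (Metric.ball 0 1) := by
    simpa [sq, smul_eq_mul] using hc.smul hc
  have h := congrArg norm (pi_mul_eq_setIntegral_ball hG)
  have h2 := norm_integral_le_integral_norm (μ := volume.restrict (Metric.ball (0 : ℂ) 1))
    fun z => g (w + ρ * z) ^ 2
  rw [← h] at h2
  simp only [mul_zero, add_zero, norm_mul, norm_pow, Complex.norm_real, Real.norm_eq_abs,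
    abs_of_pos Real.pi_pos] at h2
  have h3 := Measure.setIntegral_comp_smul_of_pos (volume : Measure ℂ)
    (fun z => ‖g (w + z)‖ ^ 2) (Metric.ball 0 1) hρ
  have h4 : ρ • Metric.ball (0 : ℂ) 1 = Metric.ball 0 ρ := by
    rw [smul_unitBall hρ.ne', Real.norm_eq_abs, abs_of_pos hρ]
  have h5 := (measurePreserving_add_left (volume : Measure ℂ) w).setIntegral_preimage_emb
    (Homeomorph.addLeft w).measurableEmbedding (fun z => ‖g z‖ ^ 2) (Metric.ball w ρ)
  have h6 : (fun z => w + z) ⁻¹' Metric.ball w ρ = Metric.ball (0 : ℂ) ρ := by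
    ext z; simp [dist_eq_norm]
  rw [h6] at h5
  rw [h4, h5, Complex.finrank_real_complex, smul_eq_mul] at h3
  simp only [Complex.real_smul] at h3
  rw [h3] at h2
  have hρ2 : 0 < ρ ^ 2 := by positivity
  rw [← div_eq_inv_mul, le_div_iff₀ hρ2] at h2
  linarith

/-! ### Point evaluations and kernels for the weight `(log⁺ r)²` -/

namespace FockSpace

theorem exp_weight_of_nonneg {z : ℂ} (hz : 0 ≤ Real.log ‖z‖) :
    Real.exp (-2 * logPlusSq ‖z‖₊) = Real.exp (-2 * Real.log ‖z‖ ^ 2) := by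
  have : logPlusSq ‖z‖₊ = Real.posLog ‖z‖ ^ 2 := rfl
  rw [this, Real.posLog, max_eq_right hz]

theorem exp_weight_of_nonpos {z : ℂ} (hz : Real.log ‖z‖ ≤ 0) :
    Real.exp (-2 * logPlusSq ‖z‖₊) = 1 := by
  have : logPlusSq ‖z‖₊ = Real.posLog ‖z‖ ^ 2 := rfl
  rw [this, Real.posLog, max_eq_left hz]; simp

/-- An entire function dominated by an integrable function belongs to the space. -/
theorem exists_toFun_eq {φ : ℝ≥0 →o ℝ} {f : ℂ → ℂ} (hf : Differentiable ℂ f) {g : ℂ → ℝ}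
    (hg : Integrable g)
    (h : ∀ z ≠ 0, ‖f z‖ ^ 2 * Real.exp (-2 * φ ‖z‖₊) ≤ g z) :
    ∃ F : FockSpace φ, F.toFun = f ∧ ‖F‖ ^ 2 ≤ ∫ z, g z := by
  have hae : ∀ᵐ z : ℂ, ‖f z‖ ^ 2 * Real.exp (-2 * φ ‖z‖₊) ≤ g z := by
    filter_upwards [compl_mem_ae_iff.2 (measure_singleton (0 : ℂ))] with z hz
    exact h z hz
  have hm : AEStronglyMeasurable (fun z : ℂ => ‖f z‖ ^ 2 * Real.exp (-2 * φ ‖z‖₊)) volume := by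
    simp_rw [← Fock.norm_wt_sq]
    exact (Fock.aesm_wt φ hf).norm.pow 2
  have hi : Integrable (fun z : ℂ => ‖f z‖ ^ 2 * Real.exp (-2 * φ ‖z‖₊)) volume := by
    refine hg.mono' hm ?_
    filter_upwards [hae] with z hz
    rwa [Real.norm_eq_abs, abs_of_nonneg (by positivity)]
  let F : FockSpace φ := ⟨f, hf, hi⟩
  refine ⟨F, rfl, ?_⟩
  rw [norm_sq_eq]
  exact integral_mono_ae hi hg hae

theorem three_halves_le_norm {w : ℂ} (hw : 1 / 2 ≤ Real.log ‖w‖) : 3 / 2 ≤ ‖w‖ := by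
  have hpos : 0 < ‖w‖ := by
    refine norm_pos_iff.2 fun h => ?_
    rw [h, norm_zero, Real.log_zero] at hw
    norm_num at hw
  rw [← Real.exp_log hpos]
  have := Real.add_one_le_exp (Real.log ‖w‖)
  linarith

/-- Local control of point values. On the disc, `f / z ^ N` with `N` the integer part of
`2 log |w|` is holomorphic and `|z| ^ (-2 N)` is comparable to the weight, up to a constant factor,
because `2 t ^ 2 - 2 N t = 2 (t - N / 2) ^ 2 - N ^ 2 / 2`; hence the area mean value inequality for
`f / z ^ N` gives one for `f` with the weight. -/
theorem exists_norm_sq_le : ∃ C : ℝ, 0 < C ∧ ∀ (f : FockSpace logPlusSq) (w : ℂ),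
    1 / 2 ≤ Real.log ‖w‖ → ‖f.toFun w‖ ^ 2 ≤
      C * Real.exp (2 * Real.log ‖w‖ ^ 2 - 2 * Real.log ‖w‖) *
        ∫ z in Metric.ball w (‖w‖ / 5), ‖f.toFun z‖ ^ 2 * Real.exp (-2 * logPlusSq ‖z‖₊) := by
  refine ⟨25 / Real.pi * Real.exp (9 / 8), by positivity, fun f w hw => ?_⟩
  set t := Real.log ‖w‖ with ht
  have hw1 := three_halves_le_norm hw
  have hwpos : 0 < ‖w‖ := by linarith
  set N := ⌊2 * t⌋₊ with hN
  have hN1 : (N : ℝ) ≤ 2 * t := Nat.floor_le (by linarith)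
  have hN2 : 2 * t < N + 1 := Nat.lt_floor_add_one _
  have hball : ∀ z ∈ Metric.closedBall w (‖w‖ / 5),
      1 ≤ ‖z‖ ∧ |Real.log ‖z‖ - t| ≤ 1 / 4 := by
    intro z hz
    rw [Metric.mem_closedBall, dist_eq_norm] at hz
    have h1 : ‖z‖ ≤ 6 / 5 * ‖w‖ := by
      have := norm_le_norm_add_norm_sub' z w
      linarith
    have h2 : 4 / 5 * ‖w‖ ≤ ‖z‖ := by
      have := norm_le_norm_add_norm_sub z w
      linarith
    have hzpos : 0 < ‖z‖ := by linarith
    refine ⟨by linarith, ?_⟩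
    rw [ht, ← Real.log_div hzpos.ne' hwpos.ne']
    have h3 : ‖z‖ / ‖w‖ ≤ 6 / 5 := by rwa [div_le_iff₀ hwpos]
    have h4 : 4 / 5 ≤ ‖z‖ / ‖w‖ := by rwa [le_div_iff₀ hwpos]
    have h5 := Real.log_le_sub_one_of_pos (div_pos hzpos hwpos)
    have h6 := Real.one_sub_inv_le_log_of_pos (div_pos hzpos hwpos)
    have h7 : (‖z‖ / ‖w‖)⁻¹ ≤ (4 / 5)⁻¹ := by gcongr
    rw [abs_le]
    constructor
    · norm_num at h6 h7; linarith
    · linarith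
  have hne : ∀ z ∈ Metric.closedBall w (‖w‖ / 5), z ≠ 0 := fun z hz h => by
    have := (hball z hz).1
    rw [h, norm_zero] at this
    linarith
  have hρ : 0 < ‖w‖ / 5 := by positivity
  have hdiff : DiffContOnCl ℂ (fun z => f.toFun z / z ^ N) (Metric.ball w (‖w‖ / 5)) := by
    refine DifferentiableOn.diffContOnCl ?_
    rw [closure_ball w hρ.ne']
    exact f.differentiable.differentiableOn.div (differentiable_id.pow N).differentiableOn
      fun z hz => pow_ne_zero _ (hne z hz)
  have hmv := pi_mul_sq_mul_norm_sq_le hρ hdiff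
  have hcmp : ∫ z in Metric.ball w (‖w‖ / 5), ‖f.toFun z / z ^ N‖ ^ 2 ≤
      Real.exp (9 / 8 - N ^ 2 / 2) *
        ∫ z in Metric.ball w (‖w‖ / 5), ‖f.toFun z‖ ^ 2 * Real.exp (-2 * logPlusSq ‖z‖₊) := by
    rw [← integral_const_mul]
    refine setIntegral_mono_on ?_ (f.integrable_norm_sq.integrableOn.const_mul _)
      measurableSet_ball fun z hz => ?_
    · have hc := hdiff.continuousOn_ball
      exact ((hc.norm.pow 2).integrableOn_compact (isCompact_closedBall _ _)).mono_set
        Metric.ball_subset_closedBall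
    · obtain ⟨h1, h2⟩ := hball z (Metric.ball_subset_closedBall hz)
      have hzpos : 0 < ‖z‖ := by linarith
      rw [exp_weight_of_nonneg (Real.log_nonneg h1), norm_div, norm_pow, div_pow]
      have h3 : (‖z‖ ^ N) ^ 2 = Real.exp (2 * N * Real.log ‖z‖) := by
        rw [← pow_mul]
        conv_lhs => rw [← Real.exp_log hzpos, ← Real.exp_nat_mul]
        congr 1; push_cast; ring
      rw [h3, div_eq_mul_inv, ← Real.exp_neg, mul_left_comm, ← Real.exp_add]
      gcongr
      have h4 := abs_le.1 h2
      nlinarith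
  have hwN : ‖f.toFun w‖ ^ 2 =
      Real.exp (2 * N * t) * ‖f.toFun w / w ^ N‖ ^ 2 := by
    rw [norm_div, norm_pow, div_pow]
    have h3 : (‖w‖ ^ N) ^ 2 = Real.exp (2 * N * t) := by
      rw [← pow_mul]
      conv_lhs => rw [← Real.exp_log hwpos, ← Real.exp_nat_mul]
      congr 1; push_cast; ring
    rw [h3]
    field_simp
  set J := ∫ z in Metric.ball w (‖w‖ / 5), ‖f.toFun z‖ ^ 2 * Real.exp (-2 * logPlusSq ‖z‖₊)
    with hJ
  have hJ0 : 0 ≤ J := integral_nonneg fun z => by positivity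
  have hw2 : ‖w‖ ^ 2 = Real.exp (2 * t) := by
    conv_lhs => rw [← Real.exp_log hwpos, ← Real.exp_nat_mul]
    congr 1
  have h8 : ‖f.toFun w / w ^ N‖ ^ 2 ≤
      25 / Real.pi * Real.exp (-2 * t) * (Real.exp (9 / 8 - N ^ 2 / 2) * J) := by
    have h9 := hmv.trans hcmp
    rw [div_pow, hw2] at h9
    have h10 : Real.exp (-2 * t) * Real.exp (2 * t) = 1 := by rw [← Real.exp_add]; simp
    have hpi := Real.pi_pos
    calc ‖f.toFun w / w ^ N‖ ^ 2 = 25 / Real.pi * Real.exp (-2 * t) *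
          (Real.pi * (Real.exp (2 * t) / 5 ^ 2) * ‖f.toFun w / w ^ N‖ ^ 2) := by
          have : 25 / Real.pi * Real.exp (-2 * t) *
            (Real.pi * (Real.exp (2 * t) / 5 ^ 2) * ‖f.toFun w / w ^ N‖ ^ 2) =
            (Real.exp (-2 * t) * Real.exp (2 * t)) * ‖f.toFun w / w ^ N‖ ^ 2 := by
            field_simp; norm_num
          rw [this, h10, one_mul]
      _ ≤ _ := by gcongr
  rw [hwN]
  calc Real.exp (2 * N * t) * ‖f.toFun w / w ^ N‖ ^ 2
      ≤ Real.exp (2 * N * t) *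
        (25 / Real.pi * Real.exp (-2 * t) * (Real.exp (9 / 8 - N ^ 2 / 2) * J)) := by gcongr
    _ = 25 / Real.pi * (Real.exp (2 * N * t) * Real.exp (-2 * t) *
          Real.exp (9 / 8 - N ^ 2 / 2)) * J := by ring
    _ ≤ 25 / Real.pi * (Real.exp (9 / 8) * Real.exp (2 * t ^ 2 - 2 * t)) * J := by
        gcongr 25 / Real.pi * ?_ * _
        rw [← Real.exp_add, ← Real.exp_add, ← Real.exp_add]
        apply Real.exp_le_exp.2
        nlinarith [sq_nonneg (2 * t - N)]
    _ = _ := by ring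

theorem exists_norm_le : ∃ C : ℝ, 0 < C ∧ ∀ (f : FockSpace logPlusSq) (w : ℂ),
    1 / 2 ≤ Real.log ‖w‖ → ‖f.toFun w‖ ≤
      C * Real.exp (Real.log ‖w‖ ^ 2 - Real.log ‖w‖) * ‖f‖ := by
  obtain ⟨C, hC, h⟩ := exists_norm_sq_le
  refine ⟨√C, Real.sqrt_pos.2 hC, fun f w hw => ?_⟩
  refine le_of_sq_le_sq ?_ (by positivity)
  rw [mul_pow, mul_pow, Real.sq_sqrt hC.le, ← Real.exp_nat_mul, norm_sq_eq]
  refine (h f w hw).trans ?_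
  have h1 : 2 * Real.log ‖w‖ ^ 2 - 2 * Real.log ‖w‖ =
      (2 : ℕ) * (Real.log ‖w‖ ^ 2 - Real.log ‖w‖) := by push_cast; ring
  rw [h1]
  gcongr
  · exact ae_of_all _ fun z => by positivity
  · exact f.integrable_norm_sq
  · exact Measure.restrict_le_self

theorem norm_reproducingKernel_sq (φ : ℝ≥0 →o ℝ) (w : ℂ) :
    ‖reproducingKernel φ w‖ ^ 2 = ‖(reproducingKernel φ w).toFun w‖ := by
  have h := inner_reproducingKernel w (reproducingKernel φ w)
  rw [inner_self_eq_norm_sq_to_K] at h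
  have h2 := congrArg norm h
  rw [coe_eq_toFun] at h2
  simpa using h2

theorem exists_norm_reproducingKernel_le : ∃ C : ℝ, 0 < C ∧ ∀ w : ℂ, 1 / 2 ≤ Real.log ‖w‖ →
    ‖reproducingKernel logPlusSq w‖ ≤ C * Real.exp (Real.log ‖w‖ ^ 2 - Real.log ‖w‖) := by
  obtain ⟨C, hC, h⟩ := exists_norm_le
  refine ⟨C, hC, fun w hw => ?_⟩
  have h1 := h (reproducingKernel logPlusSq w) w hw
  rw [← norm_reproducingKernel_sq] at h1
  rcases eq_or_ne ‖reproducingKernel logPlusSq w‖ 0 with h0 | h0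
  · rw [h0]; positivity
  · have hp := lt_of_le_of_ne (norm_nonneg _) (Ne.symm h0)
    rw [sq] at h1
    exact le_of_mul_le_mul_right h1 hp

theorem norm_pow_sq_mul_exp_weight_le (n : ℕ) {z : ℂ} (hz : z ≠ 0) :
    ‖z ^ n‖ ^ 2 * Real.exp (-2 * logPlusSq ‖z‖₊) ≤
      Real.exp (((n : ℝ) + 1) ^ 2 / 2 + 1) * radialBump (((n : ℝ) + 1) / 2) z := by
  have hz' : 0 < ‖z‖ := norm_pos_iff.2 hz
  have hn : (0 : ℝ) ≤ n := n.cast_nonneg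
  rw [radialBump, norm_pow]
  set t := Real.log ‖z‖ with ht
  have h1 : (‖z‖ ^ n) ^ 2 = Real.exp (2 * n * t) := by
    rw [← pow_mul]
    conv_lhs => rw [← Real.exp_log hz', ← Real.exp_nat_mul]
    congr 1; push_cast; ring
  have h2 : (‖z‖ ^ 2)⁻¹ = Real.exp (-(2 * t)) := by
    conv_lhs => rw [← Real.exp_log hz', ← Real.exp_nat_mul, ← Real.exp_neg]
    congr 1
  rw [h1, h2]
  rcases le_total 0 t with h | h
  · rw [exp_weight_of_nonneg h, ← ht, ← Real.exp_add, ← Real.exp_add, ← Real.exp_add]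
    apply Real.exp_le_exp.2
    have h3 := sq_abs (t - ((n : ℝ) + 1) / 2)
    nlinarith [sq_nonneg (2 * |t - ((n : ℝ) + 1) / 2| - 1 / 2)]
  · rw [exp_weight_of_nonpos h, mul_one, ← Real.exp_add, ← Real.exp_add]
    apply Real.exp_le_exp.2
    rw [abs_of_nonpos (by linarith)]
    nlinarith

/-- The lower bound for the kernel at the nodes, from the monomial `z ^ n` as a test function. -/
theorem exists_le_norm_reproducingKernel : ∃ c : ℝ, 0 < c ∧ ∀ (n : ℕ) (w : ℂ),
    Real.log ‖w‖ = ((n : ℝ) + 1) / 2 →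
    c * Real.exp (Real.log ‖w‖ ^ 2 - Real.log ‖w‖) ≤ ‖reproducingKernel logPlusSq w‖ := by
  set I := ∫ z, radialBump 0 z with hI
  have hI0 : 0 ≤ I := integral_nonneg (radialBump.nonneg 0)
  set D := Real.exp 1 * I + 1 with hD
  have hD0 : 0 < D := by positivity
  refine ⟨(√D)⁻¹, by positivity, fun n w hw => ?_⟩
  set t := Real.log ‖w‖ with ht
  obtain ⟨F, hF, hFn⟩ := exists_toFun_eq (φ := logPlusSq) (f := fun z => z ^ n)
    (differentiable_id.pow n) ((radialBump.integrable _).const_mul _)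
    fun z hz => norm_pow_sq_mul_exp_weight_le n hz
  rw [integral_const_mul, radialBump.integral_eq, ← hI] at hFn
  have hFn2 : ‖F‖ ≤ √D * Real.exp (t ^ 2) := by
    refine le_of_sq_le_sq ?_ (by positivity)
    rw [mul_pow, Real.sq_sqrt hD0.le, ← Real.exp_nat_mul]
    refine hFn.trans ?_
    have h1 : ((n : ℝ) + 1) ^ 2 / 2 + 1 = 1 + (2 : ℕ) * t ^ 2 := by rw [hw]; push_cast; ring
    rw [h1, Real.exp_add]
    have := Real.exp_pos ((2 : ℕ) * t ^ 2)
    nlinarith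
  have hwpos : 0 < ‖w‖ := by
    have h1 : 1 / 2 ≤ t := by rw [hw]; have : (0 : ℝ) ≤ n := n.cast_nonneg; linarith
    linarith [three_halves_le_norm h1]
  have h2 : ‖F.toFun w‖ = Real.exp (n * t) := by
    rw [hF, norm_pow]
    conv_lhs => rw [← Real.exp_log hwpos, ← Real.exp_nat_mul]
  have h3 := norm_inner_le_norm (𝕜 := ℂ) (reproducingKernel logPlusSq w) F
  rw [inner_reproducingKernel, coe_eq_toFun, h2] at h3
  have h4 : (n : ℝ) * t = (t ^ 2 - t) + t ^ 2 := by
    have : (n : ℝ) = 2 * t - 1 := by rw [hw]; ring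
    rw [this]; ring
  rw [h4, Real.exp_add] at h3
  have h5 : Real.exp (t ^ 2 - t) * Real.exp (t ^ 2) ≤
      (‖reproducingKernel logPlusSq w‖ * √D) * Real.exp (t ^ 2) := by
    refine h3.trans ?_
    rw [mul_assoc]
    gcongr
  have h6 := le_of_mul_le_mul_right h5 (Real.exp_pos _)
  rw [inv_mul_le_iff₀ (by positivity)]
  linarith

end FockSpace

/-! ### The Bessel inequality for the normalized kernels -/

namespace GeometricNodes

variable {Λ : ℕ → ℂ}

theorem log_norm (hΛ : ∀ n, ‖Λ n‖ = Real.exp (((n : ℝ) + 1) / 2)) (n : ℕ) :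
    Real.log ‖Λ n‖ = ((n : ℝ) + 1) / 2 := by rw [hΛ, Real.log_exp]

theorem half_le_log_norm (hΛ : ∀ n, ‖Λ n‖ = Real.exp (((n : ℝ) + 1) / 2)) (n : ℕ) :
    1 / 2 ≤ Real.log ‖Λ n‖ := by
  rw [log_norm hΛ]
  have : (0 : ℝ) ≤ n := n.cast_nonneg
  linarith

theorem ne_zero (hΛ : ∀ n, ‖Λ n‖ = Real.exp (((n : ℝ) + 1) / 2)) (n : ℕ) : Λ n ≠ 0 := by
  rw [← norm_pos_iff, hΛ]; exact Real.exp_pos _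

theorem injective (hΛ : ∀ n, ‖Λ n‖ = Real.exp (((n : ℝ) + 1) / 2)) : Function.Injective Λ := by
  intro m n h
  have h1 := congrArg (fun z : ℂ => Real.log ‖z‖) h
  simp only [log_norm hΛ] at h1
  have : (m : ℝ) = n := by linarith
  exact_mod_cast this

/-- The discs are disjoint since consecutive moduli have ratio `exp (1 / 2) ≥ 3 / 2` and
`(3 / 2 - 1) / (3 / 2 + 1) = 1 / 5`. -/
theorem pairwise_disjoint_ball (hΛ : ∀ n, ‖Λ n‖ = Real.exp (((n : ℝ) + 1) / 2)) :
    Pairwise (Function.onFun Disjoint fun n => Metric.ball (Λ n) (‖Λ n‖ / 5)) := by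
  refine (pairwise_disjoint_on _).2 fun m n hmn => ?_
  refine Metric.ball_disjoint_ball ?_
  have h1 : 3 / 2 * ‖Λ m‖ ≤ ‖Λ n‖ := by
    rw [hΛ, hΛ]
    have h2 : (m : ℝ) + 1 ≤ n := by exact_mod_cast hmn
    have h3 : Real.exp (1 / 2) * Real.exp (((m : ℝ) + 1) / 2) ≤ Real.exp (((n : ℝ) + 1) / 2) := by
      rw [← Real.exp_add]; apply Real.exp_le_exp.2; linarith
    have h4 := Real.add_one_le_exp (1 / 2 : ℝ)
    have h5 := Real.exp_pos (((m : ℝ) + 1) / 2)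
    nlinarith
  have h6 : ‖Λ n‖ - ‖Λ m‖ ≤ dist (Λ m) (Λ n) := by
    rw [dist_comm, dist_eq_norm]; exact norm_sub_norm_le _ _
  linarith

end GeometricNodes

namespace FockSpace

open GeometricNodes

variable {Λ : ℕ → ℂ}

theorem inner_normalizedKernel (φ : ℝ≥0 →o ℝ) (w : ℂ) (f : FockSpace φ) :
    ⟪normalizedKernel φ w, f⟫_ℂ = f w / (‖reproducingKernel φ w‖ : ℂ) := by
  rw [normalizedKernel, inner_smul_left, inner_reproducingKernel, Complex.conj_ofReal]
  push_cast
  rw [div_eq_inv_mul]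

theorem exists_bessel (hΛ : ∀ n, ‖Λ n‖ = Real.exp (((n : ℝ) + 1) / 2)) :
    ∃ B : ℝ, 0 ≤ B ∧ ∀ (f : FockSpace logPlusSq) (s : Finset ℕ),
      ∑ n ∈ s, ‖⟪normalizedKernel logPlusSq (Λ n), f⟫_ℂ‖ ^ 2 ≤ B * ‖f‖ ^ 2 := by
  obtain ⟨C, hC, hCb⟩ := exists_norm_sq_le
  obtain ⟨c, hc, hcb⟩ := exists_le_norm_reproducingKernel
  refine ⟨C / c ^ 2, by positivity, fun f s => ?_⟩
  set u : ℂ → ℝ := fun z => ‖f.toFun z‖ ^ 2 * Real.exp (-2 * logPlusSq ‖z‖₊) with hu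
  have hterm : ∀ n ∈ s, ‖⟪normalizedKernel logPlusSq (Λ n), f⟫_ℂ‖ ^ 2 ≤
      C / c ^ 2 * ∫ z in Metric.ball (Λ n) (‖Λ n‖ / 5), u z := by
    intro n _
    have h1 := hCb f (Λ n) (half_le_log_norm hΛ n)
    have h2 := hcb n (Λ n) (log_norm hΛ n)
    set t := Real.log ‖Λ n‖
    set k := ‖reproducingKernel logPlusSq (Λ n)‖
    set J := ∫ z in Metric.ball (Λ n) (‖Λ n‖ / 5), u z
    have hJ : 0 ≤ J := integral_nonneg fun z => by positivity
    rw [inner_normalizedKernel, norm_div, Complex.norm_real, norm_norm, coe_eq_toFun, div_pow]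
    have hk : 0 < k := lt_of_lt_of_le (by positivity) h2
    rw [div_le_iff₀ (by positivity)]
    refine h1.trans ?_
    have h3 : Real.exp (2 * t ^ 2 - 2 * t) = Real.exp (t ^ 2 - t) ^ 2 := by
      rw [← Real.exp_nat_mul]; congr 1; push_cast; ring
    rw [h3]
    calc C * Real.exp (t ^ 2 - t) ^ 2 * J = C / c ^ 2 * J * (c * Real.exp (t ^ 2 - t)) ^ 2 := by
          field_simp
      _ ≤ C / c ^ 2 * J * k ^ 2 := by gcongr
  refine (Finset.sum_le_sum hterm).trans ?_
  rw [← Finset.mul_sum, norm_sq_eq]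
  gcongr
  rw [← integral_biUnion_finset s (fun n _ => measurableSet_ball)
    ((pairwise_disjoint_ball hΛ).set_pairwise _) fun n _ => f.integrable_norm_sq.integrableOn]
  exact setIntegral_le_integral f.integrable_norm_sq (ae_of_all _ fun z => by positivity)

/-! ### Products over nodes and uniqueness -/

theorem norm_div_eq (hΛ : ∀ n, ‖Λ n‖ = Real.exp (((n : ℝ) + 1) / 2)) {z : ℂ} {t : ℝ}
    (hz : ‖z‖ = Real.exp t) (k : ℕ) : ‖z / Λ k‖ = Real.exp (t - ((k : ℝ) + 1) / 2) := by
  rw [norm_div, hz, hΛ, Real.exp_sub]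

theorem norm_prod_le (hΛ : ∀ n, ‖Λ n‖ = Real.exp (((n : ℝ) + 1) / 2)) {z : ℂ} {t : ℝ}
    (hz : ‖z‖ ≤ Real.exp t) (s : Finset ℕ) :
    ‖∏ k ∈ s, (1 - z / Λ k)‖ ≤ ∏ k ∈ s, (1 + Real.exp (t - ((k : ℝ) + 1) / 2)) := by
  rw [norm_prod]
  refine Finset.prod_le_prod (fun k _ => norm_nonneg _) fun k _ => ?_
  refine (norm_sub_le _ _).trans ?_
  rw [norm_one, norm_div, hΛ, Real.exp_sub]
  gcongr

theorem le_norm_prod (hΛ : ∀ n, ‖Λ n‖ = Real.exp (((n : ℝ) + 1) / 2)) {z : ℂ} {t : ℝ}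
    (hz : ‖z‖ = Real.exp t) (s : Finset ℕ) :
    ∏ k ∈ s, |1 - Real.exp (t - ((k : ℝ) + 1) / 2)| ≤ ‖∏ k ∈ s, (1 - z / Λ k)‖ := by
  rw [norm_prod]
  refine Finset.prod_le_prod (fun k _ => abs_nonneg _) fun k _ => ?_
  have h := abs_norm_sub_norm_le (1 : ℂ) (z / Λ k)
  rwa [norm_one, norm_div_eq hΛ hz] at h

/-- Division of an entire function by finitely many of its zeros. -/
theorem exists_eq_prod_mul (hΛ : ∀ n, ‖Λ n‖ = Real.exp (((n : ℝ) + 1) / 2)) {f : ℂ → ℂ}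
    (hf : Differentiable ℂ f) (h0 : ∀ n, f (Λ n) = 0) (K : ℕ) :
    ∃ h : ℂ → ℂ, Differentiable ℂ h ∧
      ∀ z, f z = (∏ k ∈ Finset.range K, (1 - z / Λ k)) * h z := by
  induction K with
  | zero => exact ⟨f, hf, by simp⟩
  | succ K ih =>
    obtain ⟨h, hd, hfh⟩ := ih
    have hz : h (Λ K) = 0 := by
      have h1 := hfh (Λ K)
      rw [h0] at h1
      refine (mul_eq_zero.1 h1.symm).resolve_left ?_
      refine Finset.prod_ne_zero_iff.2 fun k hk h2 => ?_
      have h3 : Λ K = Λ k := by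
        rw [sub_eq_zero, eq_comm, div_eq_one_iff_eq (ne_zero hΛ k)] at h2
        exact h2
      have h4 := injective hΛ h3
      rw [Finset.mem_range] at hk
      omega
    refine ⟨fun z => -Λ K * dslope h (Λ K) z, ?_, fun z => ?_⟩
    · refine Differentiable.const_mul ?_ _
      rw [← differentiableOn_univ, Complex.differentiableOn_dslope univ_mem]
      exact hd.differentiableOn
    · have h5 := sub_smul_dslope h (Λ K) z
      rw [hz, sub_zero, smul_eq_mul] at h5
      rw [hfh z, Finset.prod_range_succ, ← h5]
      have := ne_zero hΛ K
      field_simp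
      ring

/-- A function vanishing at all nodes, divided by the product over the first `K` nodes, is
`O (exp (-K / 4))` on the circle of radius `exp (K / 2 + 1 / 4)`, halfway between the moduli of
two consecutive nodes; by the maximum principle it vanishes in the limit. -/
theorem eq_zero_of_forall_eq_zero (hΛ : ∀ n, ‖Λ n‖ = Real.exp (((n : ℝ) + 1) / 2))
    (f : FockSpace logPlusSq) (h0 : ∀ n, f.toFun (Λ n) = 0) : f = 0 := by
  obtain ⟨C, hC, hCb⟩ := exists_norm_le
  obtain ⟨c, hc, hcb⟩ := exists_le_prod_abs_one_sub
  obtain ⟨D, hD, hDb⟩ := exists_prod_one_add_le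
  refine toFun_injective (funext fun z => ?_)
  change f.toFun z = 0
  set t₀ := Real.log (‖z‖ + 1) with ht₀
  have hzp : 0 < ‖z‖ + 1 := by positivity
  have ht₀0 : 0 ≤ t₀ := Real.log_nonneg (by linarith [norm_nonneg z])
  have hz : ‖z‖ ≤ Real.exp t₀ := by rw [ht₀, Real.exp_log hzp]; linarith
  set E := D * Real.exp (t₀ ^ 2 - t₀ / 2 + 1 / 16) with hE
  have hlim : Tendsto (fun K : ℕ => E * (C / c * ‖f‖ * Real.exp (-(1 / 4) * K))) atTop (𝓝 0) := by
    have h1 : Tendsto (fun K : ℕ => Real.exp (-(1 / 4) * K)) atTop (𝓝 0) := by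
      refine Real.tendsto_exp_atBot.comp ?_
      exact tendsto_natCast_atTop_atTop.const_mul_atTop_of_neg (by norm_num)
    simpa using (h1.const_mul (C / c * ‖f‖)).const_mul E
  have hbound : ∀ᶠ K : ℕ in atTop,
      ‖f.toFun z‖ ≤ E * (C / c * ‖f‖ * Real.exp (-(1 / 4) * K)) := by
    filter_upwards [eventually_ge_atTop (max 1 ⌈2 * t₀⌉₊)] with K hK
    have hK1 : (1 : ℝ) ≤ K := by exact_mod_cast (le_max_left _ _).trans hK
    have hK2 : 2 * t₀ ≤ K := (Nat.le_ceil _).trans (by exact_mod_cast (le_max_right _ _).trans hK)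
    obtain ⟨h, hd, hfh⟩ := exists_eq_prod_mul hΛ f.differentiable h0 K
    set t : ℝ := K / 2 + 1 / 4 with ht
    have hsphere : ∀ w ∈ frontier (Metric.ball (0 : ℂ) (Real.exp t)),
        ‖h w‖ ≤ C / c * ‖f‖ * Real.exp (-(1 / 4) * K) := by
      intro w hw
      rw [frontier_ball _ (Real.exp_pos _).ne', mem_sphere_zero_iff_norm] at hw
      have hlog : Real.log ‖w‖ = t := by rw [hw, Real.log_exp]
      have h1 := hCb f w (by rw [hlog]; linarith)
      rw [hlog, hfh, norm_mul] at h1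
      have h2 : c * Real.exp (K ^ 2 / 4) ≤ ‖∏ k ∈ Finset.range K, (1 - w / Λ k)‖ := by
        refine le_trans ?_ (le_norm_prod hΛ hw _)
        refine le_trans ?_ (hcb t _ fun k hk => ?_)
        · gcongr
          have := le_sum_excess (le_refl K) t
          refine le_trans (le_of_eq ?_) this
          rw [ht]; ring
        · have hk' : (k : ℝ) + 1 ≤ K := by exact_mod_cast Finset.mem_range.1 hk
          refine le_trans ?_ (le_abs_self _)
          rw [ht]; linarith
      have h3 : c * Real.exp (K ^ 2 / 4) * ‖h w‖ ≤ C * Real.exp (t ^ 2 - t) * ‖f‖ :=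
        (mul_le_mul_of_nonneg_right h2 (norm_nonneg _)).trans h1
      have h4 : Real.exp (t ^ 2 - t) ≤ Real.exp (K ^ 2 / 4) * Real.exp (-(1 / 4) * K) := by
        rw [← Real.exp_add]; apply Real.exp_le_exp.2; rw [ht]; nlinarith
      have h5 : c * Real.exp (K ^ 2 / 4) * ‖h w‖ ≤
          c * Real.exp (K ^ 2 / 4) * (C / c * ‖f‖ * Real.exp (-(1 / 4) * K)) := by
        refine h3.trans ?_
        calc C * Real.exp (t ^ 2 - t) * ‖f‖
            ≤ C * (Real.exp (K ^ 2 / 4) * Real.exp (-(1 / 4) * K)) * ‖f‖ := by gcongr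
          _ = _ := by field_simp
      exact le_of_mul_le_mul_left h5 (by positivity)
    have hzmem : z ∈ closure (Metric.ball (0 : ℂ) (Real.exp t)) := by
      rw [closure_ball _ (Real.exp_pos _).ne', mem_closedBall_zero_iff]
      refine hz.trans (Real.exp_le_exp.2 ?_)
      rw [ht]; linarith
    have hhz := Complex.norm_le_of_forall_mem_frontier_norm_le Metric.isBounded_ball
      hd.diffContOnCl hsphere hzmem
    rw [hfh z, norm_mul]
    gcongr
    refine (norm_prod_le hΛ hz _).trans ((hDb t₀ _).trans ?_)
    rw [hE]
    gcongr
    exact sum_excess_le K ht₀0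
  exact norm_le_zero_iff.1 (ge_of_tendsto hlim hbound)

/-! ### Lagrange interpolation with uniform norm control -/

/-- The Lagrange polynomial at the node `Λ n` for the nodes `Λ k`, `k < K`. -/
noncomputable def lagrange (Λ : ℕ → ℂ) (K n : ℕ) (z : ℂ) : ℂ :=
  (∏ k ∈ (Finset.range K).erase n, (1 - z / Λ k)) /
    ∏ k ∈ (Finset.range K).erase n, (1 - Λ n / Λ k)

theorem differentiable_lagrange (Λ : ℕ → ℂ) (K n : ℕ) : Differentiable ℂ (lagrange Λ K n) := by
  unfold lagrange
  fun_prop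

theorem lagrange_eq (hΛ : ∀ n, ‖Λ n‖ = Real.exp (((n : ℝ) + 1) / 2)) {K m : ℕ} (hm : m < K)
    (n : ℕ) : lagrange Λ K n (Λ m) = if m = n then 1 else 0 := by
  unfold lagrange
  split_ifs with h
  · rw [h]
    refine div_self (Finset.prod_ne_zero_iff.2 fun k hk h2 => ?_)
    rw [sub_eq_zero, eq_comm, div_eq_one_iff_eq (ne_zero hΛ k)] at h2
    exact (Finset.mem_erase.1 hk).1 (injective hΛ h2.symm)
  · rw [Finset.prod_eq_zero (Finset.mem_erase.2 ⟨h, Finset.mem_range.2 hm⟩), zero_div]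
    rw [div_self (ne_zero hΛ m), sub_self]

/-- The weighted Lagrange polynomials are localized near the circle through their node, uniformly
in the number of nodes. -/
theorem exists_lagrange_le (hΛ : ∀ n, ‖Λ n‖ = Real.exp (((n : ℝ) + 1) / 2)) :
    ∃ C : ℝ, 0 < C ∧ ∀ (K n : ℕ), n < K → ∀ z : ℂ, z ≠ 0 →
      ‖reproducingKernel logPlusSq (Λ n)‖ * ‖lagrange Λ K n z‖ * Fock.decay logPlusSq z ≤
        C * (‖z‖⁻¹ * Real.exp (-(1 / 2) * |Real.log ‖z‖ - ((n : ℝ) + 1) / 2|)) := by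
  obtain ⟨A, hA, hAb⟩ := exists_norm_reproducingKernel_le
  obtain ⟨c, hc, hcb⟩ := exists_le_prod_abs_one_sub
  obtain ⟨D, hD, hDb⟩ := exists_prod_one_add_le
  refine ⟨A * D / c * Real.exp (1 / 16), by positivity, fun K n hn z hz => ?_⟩
  have hzpos : 0 < ‖z‖ := norm_pos_iff.2 hz
  set t := Real.log ‖z‖ with ht
  have hzt : ‖z‖ = Real.exp t := (Real.exp_log hzpos).symm
  set a : ℝ := ((n : ℝ) + 1) / 2 with ha
  have ha0 : 0 < a := by positivity
  set S := ∑ k ∈ Finset.range K, excess t k with hS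
  have hmem : n ∈ Finset.range K := Finset.mem_range.2 hn
  have herase : ∀ τ : ℝ, ∑ k ∈ (Finset.range K).erase n, excess τ k =
      ∑ k ∈ Finset.range K, excess τ k - excess τ n := fun τ => by
    rw [← Finset.add_sum_erase _ _ hmem]; ring
  have hnum : ‖∏ k ∈ (Finset.range K).erase n, (1 - z / Λ k)‖ ≤
      D * Real.exp (S - excess t n) := by
    rw [hS, ← herase]
    exact (norm_prod_le hΛ hzt.le _).trans (hDb t _)
  have hden : c * Real.exp (a ^ 2 - a / 2) ≤
      ‖∏ k ∈ (Finset.range K).erase n, (1 - Λ n / Λ k)‖ := by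
    refine le_trans ?_ (le_norm_prod hΛ (hΛ n) _)
    refine le_trans ?_ (hcb a _ fun k hk => ?_)
    · gcongr
      rw [herase]
      have h1 : excess a n = 0 := max_eq_left (by rw [ha]; simp)
      have h2 := le_sum_excess hn.le a
      rw [h1, sub_zero]
      refine le_trans (le_of_eq ?_) h2
      rw [ha]; ring
    · have hkn : k ≠ n := (Finset.mem_erase.1 hk).1
      have h3 : (1 : ℝ) ≤ |(n : ℝ) - k| := by
        have h4 : (1 : ℤ) ≤ |(n : ℤ) - k| := Int.one_le_abs (by omega)
        exact_mod_cast h4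
      have h5 : a - ((k : ℝ) + 1) / 2 = ((n : ℝ) - k) / 2 := by rw [ha]; ring
      rw [h5, abs_div, abs_of_pos (by norm_num : (0 : ℝ) < 2)]
      linarith
  have hker := hAb (Λ n) (half_le_log_norm hΛ n)
  rw [log_norm hΛ n, ← ha] at hker
  -- For `t ≥ 0` both sides agree up to constants; for `t ≤ 0` the product is bounded.
  have hexp : Real.exp (S - excess t n) * Fock.decay logPlusSq z ≤
      Real.exp (1 / 16) * Real.exp (-t + a / 2 - 1 / 2 * |t - a|) := by
    have hval : logPlusSq ‖z‖₊ = Real.posLog ‖z‖ ^ 2 := rfl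
    rw [Fock.decay, hval, Real.posLog, ← ht, ← Real.exp_add, ← Real.exp_add]
    apply Real.exp_le_exp.2
    have hx : excess t n = max 0 (t - a) := rfl
    rw [hx]
    rcases le_total 0 t with h | h
    · rw [max_eq_right h]
      have h1 := sum_excess_le K h
      rcases le_total t a with h2 | h2
      · rw [max_eq_left (by linarith), abs_of_nonpos (by linarith)]; linarith
      · rw [max_eq_right (by linarith), abs_of_nonneg (by linarith)]; linarith
    · have h1 : S = 0 := sum_excess_eq_zero h _
      rw [max_eq_left h, h1, max_eq_left (by linarith), abs_of_nonpos (by linarith)]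
      linarith
  have hdecay := Fock.decay_pos logPlusSq z
  rw [lagrange, norm_div]
  calc ‖reproducingKernel logPlusSq (Λ n)‖ *
        (‖∏ k ∈ (Finset.range K).erase n, (1 - z / Λ k)‖ /
          ‖∏ k ∈ (Finset.range K).erase n, (1 - Λ n / Λ k)‖) * Fock.decay logPlusSq z
      ≤ A * Real.exp (a ^ 2 - a) * (D * Real.exp (S - excess t n) /
          (c * Real.exp (a ^ 2 - a / 2))) * Fock.decay logPlusSq z := by gcongr
    _ = A * D / c * (Real.exp (a ^ 2 - a) / Real.exp (a ^ 2 - a / 2)) *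
          (Real.exp (S - excess t n) * Fock.decay logPlusSq z) := by field_simp
    _ ≤ A * D / c * (Real.exp (a ^ 2 - a) / Real.exp (a ^ 2 - a / 2)) *
          (Real.exp (1 / 16) * Real.exp (-t + a / 2 - 1 / 2 * |t - a|)) := by gcongr
    _ = A * D / c * Real.exp (1 / 16) * (Real.exp (a ^ 2 - a) / Real.exp (a ^ 2 - a / 2) *
          Real.exp (-t + a / 2 - 1 / 2 * |t - a|)) := by ring
    _ = _ := by
        congr 1
        rw [hzt, ← Real.exp_neg, ← Real.exp_sub, ← Real.exp_add, ← Real.exp_add]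
        congr 1; ring

/-- Finite interpolation with a norm bound independent of the number of nodes. The pointwise bound
on the Lagrange polynomials and the Cauchy–Schwarz inequality dominate the weighted square of the
interpolant by a combination of bumps with coefficients `‖a n‖ ^ 2`. -/
theorem exists_interpolation (hΛ : ∀ n, ‖Λ n‖ = Real.exp (((n : ℝ) + 1) / 2)) :
    ∃ C : ℝ, 0 < C ∧ ∀ (s : Finset ℕ) (a : ℕ → ℂ), ∃ f : FockSpace logPlusSq,
      (∀ n ∈ s, ⟪normalizedKernel logPlusSq (Λ n), f⟫_ℂ = a n) ∧
      ‖f‖ ^ 2 ≤ C * ∑ n ∈ s, ‖a n‖ ^ 2 := by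
  obtain ⟨A, hA, hAb⟩ := exists_lagrange_le hΛ
  obtain ⟨M, hM, hMb⟩ := exists_sum_exp_le (α := 1 / 2) (by norm_num)
  obtain ⟨c, hc, hcb⟩ := exists_le_norm_reproducingKernel
  set I := ∫ z, radialBump 0 z with hI
  have hI0 : 0 ≤ I := integral_nonneg (radialBump.nonneg 0)
  -- The summand `1` only makes the constant positive.
  refine ⟨A ^ 2 * M * I + 1, by positivity, fun s a => ?_⟩
  -- The polynomials interpolate `0` at the nodes below `K` outside `s`. All nodes below `K` are
  -- used because the bound on the Lagrange polynomials needs an initial segment of nodes.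
  obtain ⟨K, hK⟩ : ∃ K, ∀ n ∈ s, n < K :=
    ⟨s.sup id + 1, fun n hn => Nat.lt_succ_of_le (Finset.le_sup (f := id) hn)⟩
  let κ : ℕ → ℝ := fun n => ‖reproducingKernel logPlusSq (Λ n)‖
  let g : ℂ → ℂ := fun z => ∑ n ∈ s, a n * κ n * lagrange Λ K n z
  have hg : Differentiable ℂ g := by
    refine Differentiable.fun_sum fun n _ => ?_
    exact (differentiable_lagrange Λ K n).const_mul _
  have hint : Integrable fun z => ∑ n ∈ s,
      A ^ 2 * M * (‖a n‖ ^ 2 * radialBump (((n : ℝ) + 1) / 2) z) :=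
    integrable_finsetSum _ fun n _ => ((radialBump.integrable _).const_mul _).const_mul _
  obtain ⟨F, hF, hFn⟩ := exists_toFun_eq (φ := logPlusSq) hg hint fun z hz => by
    set e : ℕ → ℝ := fun n => Real.exp (-(1 / 2) * |Real.log ‖z‖ - ((n : ℝ) + 1) / 2|) with he
    have h1 : ‖g z‖ * Fock.decay logPlusSq z ≤ A * ‖z‖⁻¹ * ∑ n ∈ s, ‖a n‖ * e n := by
      have hdecay := Fock.decay_pos logPlusSq z
      calc ‖g z‖ * Fock.decay logPlusSq z
          ≤ (∑ n ∈ s, ‖a n * κ n * lagrange Λ K n z‖) * Fock.decay logPlusSq z := by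
            gcongr; exact norm_sum_le _ _
        _ = ∑ n ∈ s, ‖a n‖ * (κ n * ‖lagrange Λ K n z‖ * Fock.decay logPlusSq z) := by
            rw [Finset.sum_mul]
            refine Finset.sum_congr rfl fun n _ => ?_
            rw [norm_mul, norm_mul, Complex.norm_real, Real.norm_eq_abs,
              abs_of_nonneg (norm_nonneg _)]
            ring
        _ ≤ ∑ n ∈ s, ‖a n‖ * (A * (‖z‖⁻¹ * e n)) :=
            Finset.sum_le_sum fun n hn =>
              mul_le_mul_of_nonneg_left (hAb K n (hK n hn) z hz) (norm_nonneg _)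
        _ = _ := by
            rw [Finset.mul_sum]
            exact Finset.sum_congr rfl fun n _ => by ring
    have h2 : (∑ n ∈ s, ‖a n‖ * e n) ^ 2 ≤ (∑ n ∈ s, ‖a n‖ ^ 2 * e n) * M := by
      have h3 := Finset.sum_sq_le_sum_mul_sum_of_sq_le_mul s (r := fun n => ‖a n‖ * e n)
        (f := fun n => ‖a n‖ ^ 2 * e n) (g := e) (fun n _ => by positivity)
        (fun n _ => by positivity) (fun n _ => le_of_eq (by ring))
      refine h3.trans ?_
      gcongr
      exact hMb (Real.log ‖z‖) s
    rw [← Fock.decay_sq, ← mul_pow]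
    have hdecay := Fock.decay_pos logPlusSq z
    calc (‖g z‖ * Fock.decay logPlusSq z) ^ 2
        ≤ (A * ‖z‖⁻¹ * ∑ n ∈ s, ‖a n‖ * e n) ^ 2 := by gcongr
      _ = A ^ 2 * (‖z‖ ^ 2)⁻¹ * (∑ n ∈ s, ‖a n‖ * e n) ^ 2 := by
          rw [mul_pow, mul_pow, inv_pow]
      _ ≤ A ^ 2 * (‖z‖ ^ 2)⁻¹ * ((∑ n ∈ s, ‖a n‖ ^ 2 * e n) * M) := by gcongr
      _ = _ := by
          rw [Finset.sum_mul, Finset.mul_sum]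
          refine Finset.sum_congr rfl fun n _ => ?_
          have h4 : e n = Real.exp (-|Real.log ‖z‖ - ((n : ℝ) + 1) / 2| / 2) := by
            simp only [he]; congr 1; ring
          rw [radialBump, h4]
          ring
  refine ⟨F, fun n hn => ?_, hFn.trans ?_⟩
  · have hκ : (κ n : ℂ) ≠ 0 := by
      refine Complex.ofReal_ne_zero.2 (ne_of_gt ?_)
      exact lt_of_lt_of_le (by positivity) (hcb n (Λ n) (log_norm hΛ n))
    rw [inner_normalizedKernel, coe_eq_toFun, hF]
    change (∑ m ∈ s, a m * κ m * lagrange Λ K m (Λ n)) / (κ n : ℂ) = a n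
    simp_rw [lagrange_eq hΛ (hK n hn)]
    rw [Finset.sum_eq_single n (fun m _ hm => by rw [if_neg hm.symm, mul_zero])
      (fun h => absurd hn h)]
    rw [if_pos rfl, mul_one, mul_div_assoc, div_self hκ, mul_one]
  · rw [integral_finsetSum _ fun n _ => ((radialBump.integrable _).const_mul _).const_mul _]
    simp_rw [integral_const_mul, radialBump.integral_eq]
    rw [← Finset.mul_sum, ← Finset.sum_mul, ← hI]
    have : 0 ≤ ∑ n ∈ s, ‖a n‖ ^ 2 := Finset.sum_nonneg fun n _ => by positivity
    nlinarith

end FockSpace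

theorem mainTheorem2 (θ : ℕ → ℝ) (Λ : ℕ → ℂ)
    (hΛ : ∀ n, Λ n = Complex.exp (((n : ℂ) + 1) / 2 + Complex.I * (θ n : ℂ))) :
    IsRieszBasis (fun n => FockSpace.normalizedKernel logPlusSq (Λ n)) ∧
      FockSpace.IsCompleteInterpolating logPlusSq Λ := by
  have hnorm : ∀ n, ‖Λ n‖ = Real.exp (((n : ℝ) + 1) / 2) := by
    intro n
    rw [hΛ, Complex.norm_exp]
    congr 1
    have : ((n : ℂ) + 1) / 2 + Complex.I * (θ n : ℂ) =
        ((((n : ℝ) + 1) / 2 : ℝ) : ℂ) + (θ n : ℝ) * Complex.I := by push_cast; ring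
    rw [this]
    simp
  obtain ⟨B, hB0, hB⟩ := FockSpace.exists_bessel hnorm
  obtain ⟨C, hC0, hC⟩ := FockSpace.exists_interpolation hnorm
  obtain ⟨c, hc, hcb⟩ := FockSpace.exists_le_norm_reproducingKernel
  have hk : ∀ n, (‖FockSpace.reproducingKernel logPlusSq (Λ n)‖ : ℂ) ≠ 0 := fun n =>
    Complex.ofReal_ne_zero.2 (ne_of_gt
      (lt_of_lt_of_le (by positivity) (hcb n (Λ n) (GeometricNodes.log_norm hnorm n))))
  have hU : ∀ f : FockSpace logPlusSq,
      (∀ n, ⟪FockSpace.normalizedKernel logPlusSq (Λ n), f⟫_ℂ = 0) → f = 0 := fun f hf =>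
    FockSpace.eq_zero_of_forall_eq_zero hnorm f fun n => by
      have h := hf n
      rw [FockSpace.inner_normalizedKernel] at h
      exact (div_eq_zero_iff.1 h).resolve_right (hk n)
  have hL := RieszBasis.le_norm_sum_smul_sq hC0 hC
  refine ⟨⟨RieszBasis.dense_span hU, C⁻¹, B + 1, by positivity, by positivity, fun s a =>
    ⟨hL s a, (RieszBasis.norm_sum_smul_sq_le hB0 hB s a).trans ?_⟩⟩, fun a => ?_⟩
  · gcongr
    linarith
  · obtain ⟨f, hf⟩ := RieszBasis.exists_inner_eq hB0 (inv_pos.2 hC0) hB hL a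
    refine ⟨f, fun n => by rw [← FockSpace.inner_normalizedKernel]; exact hf n, fun g hg => ?_⟩
    refine sub_eq_zero.1 (hU (g - f) fun n => ?_)
    rw [inner_sub_right, hf n, FockSpace.inner_normalizedKernel, hg n, sub_self]
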